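/- Define real numbers $u_{n,k}$ and $v_n$ recursively by $u_{1,1}=1$, $u_{1,k}=0$ for $k\ne1$, $v_0=-1$, and, for $n\ge 2$, $$v_{n-1}=\frac12\sum_{m=1}^{n-1}\ \sum_{l=1}^{\min(m,n-m-1)}u_{m,l}\,u_{n-m,1+l},$$ $$(1-k)u_{n,k}+k\sum_{m=1}^{n-k} v_{m}u_{n-m,k}-\frac{k}{4}\sum_{m=1}^{n-1}\ \sum_{l=\max(1,k-n+m)}^{\min(m,k-1)}u_{m,l}u_{n-m,k-l}-\frac{k}{2}\sum_{m=1}^{n-1}\ \sum_{l=1}^{\min(m,n-m-k)}u_{m,l}u_{n-m,k+l}=0\qquad(2\le k\le n),$$ with $u_{n,k}=0$ for $k\notin[2,n]$, where empty sums are $0$. Put $u_n(x)=\sum_{k} u_{n,k}\cos(kx)$, so that $u_1=\cos$. Let $B=\sqrt{\pi^2/3+869/144}$ and let $x^*$ be the largest $x\ge0$ with $$8x+\sqrt{17}\,x^2-4\le-2\sqrt{(2Bx^2+4x)\left(x\sqrt{x^2+5/2}+\tfrac52\sinh^{-1}\!\big(\sqrt{2/5}\,x\big)\right)}.$$ Theorem.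 One has $x^*\approx0.23$ (precisely, $|x^*-0.23|<0.005$). For every $\varepsilon\in\mathbb C$ with $|\varepsilon|<x^*$ the power series $$u_\varepsilon=\sum_{n\ge1}u_n\varepsilon^n,\qquad v_\varepsilon=\sum_{n\ge0}v_n\varepsilon^n$$ converge absolutely, the first in $H^1(\mathbb T)$, $\mathbb T=\mathbb R/2\pi\mathbb Z$ (and pointwise), the second in $\mathbb C$; and their sums solve the traveling wave equation of the Burgers–Hilbert equation $f_t=Hf+ff_x$, $$Hu_\varepsilon-v_\varepsilon u_\varepsilon'+u_\varepsilon u_\varepsilon'=0\quad\text{a.e. on }\mathbb T,$$ where $u_\varepsilon'$ is the weak derivative and $H$ is the Hilbert transform, $\widehat{Hf}(k)=-i\,\mathrm{sgn}(k)\hat f(k)$. -/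

import Mathlib

open MeasureTheory Filter Topology

noncomputable section

namespace BurgersHilbert

/-! ### The coefficients of the formal expansion
`u_ε(x) = ∑_{n ≥ 1} u_n(x) ε^n`, `v_ε = ∑_{n ≥ 0} v_n ε^n`,
`u_1 = cos x`, `v_0 = -1`, `u_n = ∑_{k=2}^n u_{n,k} cos (k x)` for `n ≥ 2`. -/

/-- The value of `v_{n-1}` in terms of the `u_{m,l}` with `m < n`. -/
def vNext (n : ℕ) (u : ℕ → ℕ → ℝ) : ℝ :=
  (1 / 2) * ∑ m ∈ Finset.Icc 1 (n - 1), ∑ l ∈ Finset.Icc 1 (min m (n - m - 1)),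
    u m l * u (n - m) (1 + l)

/-- The value of `u_{n,k}` in terms of the `u_{m,l}` with `m < n` and the `v_m` with `m ≤ n - 2`.
The truncated subtractions give the intended (possibly empty) ranges of summation. -/
def uNext (n : ℕ) (u : ℕ → ℕ → ℝ) (v : ℕ → ℝ) (k : ℕ) : ℝ :=
  if 2 ≤ k ∧ k ≤ n then
    (1 / ((k : ℝ) - 1)) *
      (k * ∑ m ∈ Finset.Icc 1 (n - k), v m * u (n - m) k
        - (k / 4) * ∑ m ∈ Finset.Icc 1 (n - 1),
            ∑ l ∈ Finset.Icc (max 1 (k + m - n)) (min m (k - 1)), u m l * u (n - m) (k - l)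
        - (k / 2) * ∑ m ∈ Finset.Icc 1 (n - 1),
            ∑ l ∈ Finset.Icc 1 (min m (n - m - k)), u m l * u (n - m) (k + l))
  else 0

/-- `waveCoeff n = ((u_{n,k})_k, v_{n-1})` for `n ≥ 1`, by recursion on `n`. -/
def waveCoeff : ℕ → (ℕ → ℝ) × ℝ
  | 0 => 0
  | 1 => (Pi.single 1 1, -1)
  | n + 2 =>
    let p : ℕ → (ℕ → ℝ) × ℝ := fun m => if _h : m < n + 2 then waveCoeff m else 0
    (uNext (n + 2) (fun m => (p m).1) (fun m => (p (m + 1)).2), vNext (n + 2) (fun m => (p m).1))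
  termination_by n => n

/-- `u_{n,k}`. -/
def uCoeff (n k : ℕ) : ℝ := (waveCoeff n).1 k

/-- `v_n`. -/
def vCoeff (n : ℕ) : ℝ := (waveCoeff (n + 1)).2

/-- The trigonometric polynomial `u_n(x) = ∑_k u_{n,k} cos (k x)`; here `u_0 = 0`, `u_1 = cos`. -/
def uTerm (n : ℕ) (x : ℝ) : ℝ := ∑ k ∈ Finset.range (n + 1), uCoeff n k * Real.cos (k * x)

/-! The recurrence relations, as a check of the definition. -/

theorem uCoeff_one : uCoeff 1 = Pi.single 1 1 := by
  funext k; simp [uCoeff, waveCoeff]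

theorem vCoeff_zero : vCoeff 0 = -1 := by
  simp [vCoeff, waveCoeff]

theorem vCoeff_rec (n : ℕ) (hn : 2 ≤ n) :
    vCoeff (n - 1) = (1 / 2) * ∑ m ∈ Finset.Icc 1 (n - 1),
      ∑ l ∈ Finset.Icc 1 (min m (n - m - 1)), uCoeff m l * uCoeff (n - m) (1 + l) := by
  obtain ⟨n, rfl⟩ : ∃ j, n = j + 2 := ⟨n - 2, by omega⟩
  have h1 : vCoeff (n + 2 - 1) = (waveCoeff (n + 2)).2 := rfl
  rw [h1, waveCoeff]
  simp only [vNext]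
  congr 1
  refine Finset.sum_congr rfl fun m hm => Finset.sum_congr rfl fun l hl => ?_
  rw [Finset.mem_Icc] at hm
  rw [dif_pos (show m < n + 2 by omega), dif_pos (show n + 2 - m < n + 2 by omega)]
  rfl

theorem uCoeff_eq_zero (n k : ℕ) (hn : 2 ≤ n) (hk : ¬ (2 ≤ k ∧ k ≤ n)) : uCoeff n k = 0 := by
  obtain ⟨n, rfl⟩ : ∃ j, n = j + 2 := ⟨n - 2, by omega⟩
  rw [uCoeff, waveCoeff]
  simp only [uNext, if_neg hk]

theorem uCoeff_rec (n k : ℕ) (hk : 2 ≤ k) (hkn : k ≤ n) :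
    (1 - (k : ℝ)) * uCoeff n k
      + k * ∑ m ∈ Finset.Icc 1 (n - k), vCoeff m * uCoeff (n - m) k
      - (k / 4) * ∑ m ∈ Finset.Icc 1 (n - 1),
          ∑ l ∈ Finset.Icc (max 1 (k + m - n)) (min m (k - 1)),
            uCoeff m l * uCoeff (n - m) (k - l)
      - (k / 2) * ∑ m ∈ Finset.Icc 1 (n - 1),
          ∑ l ∈ Finset.Icc 1 (min m (n - m - k)), uCoeff m l * uCoeff (n - m) (k + l) = 0 := by
  obtain ⟨n, rfl⟩ : ∃ j, n = j + 2 := ⟨n - 2, by omega⟩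
  have hk1 : (k : ℝ) - 1 ≠ 0 := by
    have : (2 : ℝ) ≤ k := by exact_mod_cast hk
    linarith
  have e1 : uCoeff (n + 2) k = uNext (n + 2) uCoeff vCoeff k := by
    rw [uCoeff, waveCoeff]
    simp only [uNext, if_pos (And.intro hk hkn)]
    congr 2
    · congr 2
      · refine Finset.sum_congr rfl fun m hm => ?_
        rw [Finset.mem_Icc] at hm
        rw [dif_pos (show m + 1 < n + 2 by omega), dif_pos (show n + 2 - m < n + 2 by omega)]
        rfl
      · refine Finset.sum_congr rfl fun m hm => Finset.sum_congr rfl fun l hl => ?_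
        rw [Finset.mem_Icc] at hm
        rw [dif_pos (show m < n + 2 by omega), dif_pos (show n + 2 - m < n + 2 by omega)]
        rfl
    · congr 1
      refine Finset.sum_congr rfl fun m hm => Finset.sum_congr rfl fun l hl => ?_
      rw [Finset.mem_Icc] at hm
      rw [dif_pos (show m < n + 2 by omega), dif_pos (show n + 2 - m < n + 2 by omega)]
      rfl
  rw [e1, uNext, if_pos ⟨hk, hkn⟩]
  field_simp
  ring

/-- The vanishing `u_{n,k} = 0` for `n - k` odd is automatic, as is `v_n = 0` for `n` odd. -/
theorem parity_vanishing (n : ℕ) :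
    (∀ k, Odd (n + k) → uCoeff n k = 0) ∧ (Odd n → vCoeff n = 0) := by
  have key : ∀ n, ∀ k, Odd (n + k) → uCoeff n k = 0 := by
    intro n
    induction n using Nat.strong_induction_on with
    | _ n ih =>
      have hv : ∀ j, j + 1 ≤ n → Odd j → vCoeff j = 0 := by
        intro j hj hodd
        have h := vCoeff_rec (j + 1) (by have := hodd.pos; omega)
        rw [Nat.add_sub_cancel] at h
        rw [h]
        refine mul_eq_zero_of_right _ (Finset.sum_eq_zero fun m hm =>
          Finset.sum_eq_zero fun l hl => ?_)
        rw [Finset.mem_Icc] at hm hl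
        rcases Nat.even_or_odd (m + l) with he | ho
        · rw [ih (j + 1 - m) (by omega) (1 + l) (by grind), mul_zero]
        · rw [ih m (by omega) l ho, zero_mul]
      intro k hk
      rcases Nat.lt_or_ge n 2 with hn | hn
      · interval_cases n
        · simp [uCoeff, waveCoeff]
        · rw [uCoeff_one, Pi.single_apply, if_neg]
          rintro rfl
          exact absurd hk (by decide)
      by_cases hkn : 2 ≤ k ∧ k ≤ n
      · have h := uCoeff_rec n k hkn.1 hkn.2
        have s1 : ∑ m ∈ Finset.Icc 1 (n - k), vCoeff m * uCoeff (n - m) k = 0 := by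
          refine Finset.sum_eq_zero fun m hm => ?_
          rw [Finset.mem_Icc] at hm
          rcases Nat.even_or_odd m with he | ho
          · rw [ih (n - m) (by omega) k (by grind), mul_zero]
          · rw [hv m (by omega) ho, zero_mul]
        have s2 : ∑ m ∈ Finset.Icc 1 (n - 1),
            ∑ l ∈ Finset.Icc (max 1 (k + m - n)) (min m (k - 1)),
              uCoeff m l * uCoeff (n - m) (k - l) = 0 := by
          refine Finset.sum_eq_zero fun m hm => Finset.sum_eq_zero fun l hl => ?_
          rw [Finset.mem_Icc] at hm hl
          rcases Nat.even_or_odd (m + l) with he | ho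
          · rw [ih (n - m) (by omega) (k - l) (by grind), mul_zero]
          · rw [ih m (by omega) l ho, zero_mul]
        have s3 : ∑ m ∈ Finset.Icc 1 (n - 1),
            ∑ l ∈ Finset.Icc 1 (min m (n - m - k)),
              uCoeff m l * uCoeff (n - m) (k + l) = 0 := by
          refine Finset.sum_eq_zero fun m hm => Finset.sum_eq_zero fun l hl => ?_
          rw [Finset.mem_Icc] at hm hl
          rcases Nat.even_or_odd (m + l) with he | ho
          · rw [ih (n - m) (by omega) (k + l) (by grind), mul_zero]
          · rw [ih m (by omega) l ho, zero_mul]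
        rw [s1, s2, s3] at h
        have hk1 : (1 : ℝ) - k ≠ 0 := by
          have : (2 : ℝ) ≤ k := by exact_mod_cast hkn.1
          linarith
        simpa [hk1] using h
      · exact uCoeff_eq_zero n k hn hkn
  refine ⟨key n, fun hodd => ?_⟩
  have h := vCoeff_rec (n + 1) (by have := hodd.pos; omega)
  rw [Nat.add_sub_cancel] at h
  rw [h]
  refine mul_eq_zero_of_right _ (Finset.sum_eq_zero fun m hm =>
    Finset.sum_eq_zero fun l hl => ?_)
  rw [Finset.mem_Icc] at hm hl
  rcases Nat.even_or_odd (m + l) with he | ho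
  · rw [key (n + 1 - m) (1 + l) (by grind), mul_zero]
  · rw [key m l ho, zero_mul]

/-! ### The number `x*` -/

/-- The constant `B = √(π²/3 + 869/144) ≈ 3.05`. -/
def B : ℝ := Real.sqrt (Real.pi ^ 2 / 3 + 869 / 144)

/-- `x*`: the largest `x ≥ 0` satisfying the inequality below
(the set is nonempty and bounded, since the inequality forces `8 x ≤ 4`). -/
def xStar : ℝ :=
  sSup {x : ℝ | 0 ≤ x ∧
    8 * x + Real.sqrt 17 * x ^ 2 - 4 ≤
      -2 * Real.sqrt ((2 * B * x ^ 2 + 4 * x) *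
        (x * Real.sqrt (x ^ 2 + 5 / 2) + 5 / 2 * Real.arsinh (Real.sqrt (2 / 5) * x)))}

/-! ### Periodic functions, `H¹(𝕋)`, the Hilbert transform, traveling waves -/

/-- Lebesgue measure on one period `(-π, π]`. -/
def periodMeasure : Measure ℝ := volume.restrict (Set.Ioc (-Real.pi) Real.pi)

/-- The `H¹(𝕋)` norm of a smooth `2π`-periodic function. -/
def h1Norm (f : ℝ → ℝ) : ℝ :=
  Real.sqrt (∫ x in (-Real.pi)..Real.pi, (f x ^ 2 + deriv f x ^ 2))

/-- `u` is a `2π`-periodic function in `H¹(𝕋)` with weak derivative `w ∈ L²(𝕋)`;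
`w` only matters on one period. -/
structure IsH1WithDeriv (u w : ℝ → ℂ) : Prop where
  periodic : Function.Periodic u (2 * Real.pi)
  memLp : MemLp u 2 periodMeasure
  memLp_deriv : MemLp w 2 periodMeasure
  weak_deriv : ∀ φ : ℝ → ℂ, ContDiff ℝ (⊤ : ℕ∞) φ → Function.Periodic φ (2 * Real.pi) →
    ∫ x in (-Real.pi)..Real.pi, u x * deriv φ x = -∫ x in (-Real.pi)..Real.pi, w x * φ x

/-- The `k`-th Fourier coefficient of a `2π`-periodic function. -/
def fCoeff (f : ℝ → ℂ) (k : ℤ) : ℂ :=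
  (1 / (2 * Real.pi)) * ∫ x in (-Real.pi)..Real.pi, Complex.exp (-(Complex.I * k * x)) * f x

/-- `g ∈ L²(𝕋)` is the Hilbert transform of `f ∈ L²(𝕋)`, the Fourier multiplier `-i sgn k`. -/
def IsHilbertTransform (f g : ℝ → ℂ) : Prop :=
  MemLp g 2 periodMeasure ∧ ∀ k : ℤ, fCoeff g k = -Complex.I * (Int.sign k : ℂ) * fCoeff f k

/-- `u ∈ H¹(𝕋)`, with weak derivative `w`, solves `H u - v u' + u u' = 0`, that is,
`u (x + v t)` is a traveling wave of `f_t = H f + f f_x`. -/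
def IsTravelingWave (u w : ℝ → ℂ) (v : ℂ) : Prop :=
  IsH1WithDeriv u w ∧ ∃ g : ℝ → ℂ, IsHilbertTransform u g ∧
    ∀ᵐ x ∂periodMeasure, g x - v * w x + u x * w x = 0

/-- The series `∑ u_n ε^n` converges in `H¹(𝕋)` to `u`, whose weak derivative is `w`. -/
def ConvergesInH1 (ε : ℂ) (u w : ℝ → ℂ) : Prop :=
  IsH1WithDeriv u w ∧
  Tendsto (fun N : ℕ =>
    eLpNorm (fun x => (∑ n ∈ Finset.range N, (uTerm n x : ℂ) * ε ^ n) - u x) 2 periodMeasure +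
    eLpNorm (fun x => (∑ n ∈ Finset.range N, ((deriv (uTerm n) x : ℝ) : ℂ) * ε ^ n) - w x) 2
      periodMeasure) atTop (𝓝 0)

end BurgersHilbert

end

/-! The number `x*` enters only through numerical bounds: `0.226 ≤ x* ≤ 0.2349`, so `|ε| < x*`
implies `|ε| ≤ 1/4`, and everything is proved on that closed disc. Write `U_k = ∑_n |u_{n,k}|
4^{-n}` and `V = ∑_{n≥1} |v_n| 4^{-n}`. Taking absolute values in the recurrence gives, formally,
`(k-1) U_k ≤ k V U_k + (k/4) ∑_{i+j=k} U_i U_j + (k/2) ∑_l U_l U_{k+l}`. A supersolution is the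
rescaled Catalan sequence `A_k = (1/4) 5^{-(k-1)} C_{k-1}` with `A_0 = 0`. Its self-convolution is
exactly `(5/4) A_k` for `k ≥ 2`, and its decay `A_{k+l} ≤ (4/5)^l A_k` for `k ≥ 1` bounds the
correlation sum by `A_k/4` and `V` by `1/32`. The right side is then at most `(15/32) k A_k ≤ (k-1)
A_k` for `k ≥ 2`. The rigorous form (`sum_uAbs_le`) is an induction on the number of terms: both
factors of every product start at order 1, so a partial sum of products involves only shorter
partial sums. Since `A_k ≤ (4/5)^k`, even `∑_k (k+1) U_k` is finite. Hence the series of `u_n`, of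
its derivative and of its Hilbert transform converge uniformly by the M-test. This gives `H¹`
convergence and passage to Fourier coefficients, while the equation holds because the recurrence is
its `sin (k x)` coefficient at each order in `ε` (`wave_eq_term`). -/

open Finset.HasAntidiagonal (antidiagonal mem_antidiagonal)

/-! ### Cauchy products of sequences without constant term -/

open Finset in
/-- Partial sums of a Cauchy product of nonnegative sequences without constant term. -/
theorem sum_range_antidiagonal_le {f g : ℕ → ℝ} (hf : ∀ n, 0 ≤ f n) (hg : ∀ n, 0 ≤ g n)
    (hf0 : f 0 = 0) (hg0 : g 0 = 0) (N : ℕ) :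
    ∑ n ∈ range (N + 1), ∑ p ∈ antidiagonal n, f p.1 * g p.2 ≤
      (∑ n ∈ range N, f n) * ∑ n ∈ range N, g n := by
  rw [sum_mul_sum, ← sum_product', sum_sigma']
  -- Only pairs with both indices positive survive; as their sum is at most `N`, each index is below
  -- `N`. This gain of one makes the later induction close.
  have h1 : ∑ x ∈ (range (N + 1)).sigma (fun n => antidiagonal n), f x.2.1 * g x.2.2 =
      ∑ x ∈ ((range (N + 1)).sigma (fun n => antidiagonal n)).filter
        (fun x => x.2.1 ≠ 0 ∧ x.2.2 ≠ 0), f x.2.1 * g x.2.2 := by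
    symm
    apply sum_filter_of_ne
    intro x _ hx
    constructor
    · intro h; rw [h, hf0, zero_mul] at hx; exact hx rfl
    · intro h; rw [h, hg0, mul_zero] at hx; exact hx rfl
  rw [h1]
  have hinj : Set.InjOn (fun x : (_ : ℕ) × ℕ × ℕ => x.2)
      (((range (N + 1)).sigma (fun n => antidiagonal n)).filter
        (fun x => x.2.1 ≠ 0 ∧ x.2.2 ≠ 0) : Finset _) := by
    rintro ⟨n, a, b⟩ hx ⟨m, c, d⟩ hy h
    simp only [coe_filter, mem_sigma, mem_range, HasAntidiagonal.mem_antidiagonal, Set.mem_ofPred_eq] at hx hy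
    simp only [Prod.mk.injEq] at h
    obtain ⟨rfl, rfl⟩ := h
    obtain rfl : n = m := by omega
    rfl
  rw [← sum_image (f := fun p : ℕ × ℕ => f p.1 * g p.2) hinj]
  refine sum_le_sum_of_subset_of_nonneg ?_ (fun p _ _ => mul_nonneg (hf _) (hg _))
  rintro ⟨a, b⟩ h
  simp only [mem_image, mem_filter, mem_sigma, mem_range, HasAntidiagonal.mem_antidiagonal, mem_product] at h ⊢
  obtain ⟨⟨n, c, d⟩, h, h'⟩ := h
  simp only [Prod.mk.injEq] at h'
  obtain ⟨rfl, rfl⟩ := h'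
  simp only at h
  omega

open Finset in
theorem sum_Icc_eq_sum_antidiagonal (F : ℕ → ℕ → ℝ) (h0 : ∀ b, F 0 b = 0) (h1 : ∀ a, F a 0 = 0)
    (n : ℕ) : ∑ m ∈ Icc 1 (n - 1), F m (n - m) = ∑ p ∈ antidiagonal n, F p.1 p.2 := by
  rw [Finset.Nat.sum_antidiagonal_eq_sum_range_succ F]
  apply sum_subset
  · intro m hm
    simp only [mem_Icc, mem_range] at hm ⊢
    omega
  · intro m hm hm'
    simp only [mem_Icc, mem_range] at hm hm'
    rcases Nat.eq_zero_or_pos m with rfl | h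
    · exact h0 _
    · rw [show n - m = 0 by omega, h1]

/-! ### The recurrence in convolution form -/

namespace BurgersHilbert

theorem uCoeff_zero_left (k : ℕ) : uCoeff 0 k = 0 := by simp [uCoeff, waveCoeff]

theorem uCoeff_one_right (n : ℕ) : uCoeff n 1 = if n = 1 then 1 else 0 := by
  rcases Nat.lt_or_ge n 2 with h | h
  · interval_cases n
    · simp [uCoeff_zero_left]
    · simp [uCoeff_one]
  · rw [uCoeff_eq_zero n 1 h (by omega), if_neg (by omega)]

theorem uCoeff_zero_right (n : ℕ) : uCoeff n 0 = 0 := by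
  rcases Nat.lt_or_ge n 2 with h | h
  · interval_cases n
    · simp [uCoeff_zero_left]
    · simp [uCoeff_one]
  · rw [uCoeff_eq_zero n 0 h (by omega)]

theorem uCoeff_of_lt {n k : ℕ} (h : n < k) : uCoeff n k = 0 := by
  rcases Nat.lt_or_ge n 2 with h2 | h2
  · interval_cases n
    · simp [uCoeff_zero_left]
    · rw [uCoeff_one, Pi.single_apply, if_neg (by omega)]
  · rw [uCoeff_eq_zero n k h2 (by omega)]

/-- The coefficients of `v_ε + 1`. -/
noncomputable def vTail (m : ℕ) : ℝ := if m = 0 then 0 else vCoeff m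

theorem vTail_zero : vTail 0 = 0 := by simp [vTail]

/-- The added terms vanish because `u_{m,l}` is supported on `1 ≤ l ≤ m`. A range independent of `m`
and `n` permits interchanging the sums later. -/
theorem sum_Icc_uCoeff_mul (m n k M : ℕ) (hM : n ≤ M) (hmn : m ≤ n) :
    ∑ l ∈ Finset.Icc 1 (min m (n - m - k)), uCoeff m l * uCoeff (n - m) (k + l) =
      ∑ l ∈ Finset.range (M + 1), uCoeff m l * uCoeff (n - m) (k + l) := by
  apply Finset.sum_subset
  · intro l hl
    simp only [Finset.mem_Icc, Finset.mem_range] at hl ⊢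
    omega
  · intro l hl hl'
    simp only [Finset.mem_Icc, Finset.mem_range] at hl hl'
    rcases Nat.eq_zero_or_pos l with rfl | h
    · rw [uCoeff_zero_right, zero_mul]
    by_cases h1 : m < l
    · rw [uCoeff_of_lt h1, zero_mul]
    · rw [uCoeff_of_lt (n := n - m) (by omega), mul_zero]

theorem vTail_eq (n M : ℕ) (hM : n + 1 ≤ M) :
    vTail n = (1 / 2) * ∑ p ∈ antidiagonal (n + 1), ∑ l ∈ Finset.range (M + 1),
      uCoeff p.1 l * uCoeff p.2 (1 + l) := by
  rw [← sum_Icc_eq_sum_antidiagonal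
    (fun a b => ∑ l ∈ Finset.range (M + 1), uCoeff a l * uCoeff b (1 + l))
    (by simp [uCoeff_zero_left]) (by simp [uCoeff_zero_left])]
  rcases Nat.eq_zero_or_pos n with rfl | h
  · simp [vTail]
  have := vCoeff_rec (n + 1) (by omega)
  rw [vTail, if_neg (by omega)]
  rw [Nat.add_sub_cancel] at this ⊢
  rw [this]
  congr 1
  refine Finset.sum_congr rfl fun m hm => ?_
  rw [Finset.mem_Icc] at hm
  exact sum_Icc_uCoeff_mul m (n + 1) 1 M hM (by omega)

/-- The recurrence for `u_{n,k}` with the natural ranges of summation, valid for all `n`, `k`. -/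
theorem uCoeff_rec_antidiagonal (n k M : ℕ) (hM : n ≤ M) :
    (1 - (k : ℝ)) * uCoeff n k
      + k * ∑ p ∈ antidiagonal n, vTail p.1 * uCoeff p.2 k
      - (k / 4) * ∑ p ∈ antidiagonal n, ∑ q ∈ antidiagonal k,
          uCoeff p.1 q.1 * uCoeff p.2 q.2
      - (k / 2) * ∑ p ∈ antidiagonal n, ∑ l ∈ Finset.range (M + 1),
          uCoeff p.1 l * uCoeff p.2 (k + l) = 0 := by
  rcases Nat.eq_zero_or_pos k with rfl | hk
  · simp [uCoeff_zero_right]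
  rcases Nat.lt_or_ge n k with hnk | hnk
  · rw [uCoeff_of_lt hnk, Finset.sum_eq_zero, Finset.sum_eq_zero, Finset.sum_eq_zero]
    · simp
    · intro p hp
      rw [mem_antidiagonal] at hp
      refine Finset.sum_eq_zero fun l _ => ?_
      rw [uCoeff_of_lt (n := p.2) (by omega), mul_zero]
    · intro p hp
      rw [mem_antidiagonal] at hp
      refine Finset.sum_eq_zero fun q hq => ?_
      rw [mem_antidiagonal] at hq
      by_cases h1 : p.1 < q.1
      · rw [uCoeff_of_lt h1, zero_mul]
      · rw [uCoeff_of_lt (n := p.2) (by omega), mul_zero]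
    · intro p hp
      rw [mem_antidiagonal] at hp
      rw [uCoeff_of_lt (n := p.2) (by omega), mul_zero]
  -- At `k = 1` the factor `1 - k` vanishes and the identity is the solvability condition that
  -- defines `v_{n-1}`.
  obtain rfl | hk2 : k = 1 ∨ 2 ≤ k := by omega
  · obtain ⟨n, rfl⟩ : ∃ j, n = j + 1 := ⟨n - 1, by omega⟩
    have h1 : ∑ p ∈ antidiagonal (n + 1), vTail p.1 * uCoeff p.2 1 = vTail n := by
      rw [Finset.sum_eq_single (n, 1)]
      · simp [uCoeff_one_right]
      · rintro ⟨a, b⟩ hp hne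
        rw [mem_antidiagonal] at hp
        have : b ≠ 1 := by
          rintro rfl
          apply hne
          simp only [Prod.mk.injEq, and_true]
          omega
        simp [uCoeff_one_right, this]
      · simp
    have h2 : ∀ p : ℕ × ℕ, ∑ q ∈ antidiagonal 1, uCoeff p.1 q.1 * uCoeff p.2 q.2 = 0 := by
      intro p
      simp [Finset.Nat.antidiagonal_succ, uCoeff_zero_right]
    rw [h1, vTail_eq n M hM]
    simp only [h2]
    simp
  · have h := uCoeff_rec n k hk2 hnk
    have e1 : ∑ m ∈ Finset.Icc 1 (n - k), vCoeff m * uCoeff (n - m) k =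
        ∑ p ∈ antidiagonal n, vTail p.1 * uCoeff p.2 k := by
      rw [← sum_Icc_eq_sum_antidiagonal (fun a b => vTail a * uCoeff b k)
        (by simp [vTail_zero]) (by simp [uCoeff_zero_left])]
      rw [← Finset.sum_subset (s₁ := Finset.Icc 1 (n - k)) (s₂ := Finset.Icc 1 (n - 1))
        (f := fun m => vTail m * uCoeff (n - m) k)]
      · refine Finset.sum_congr rfl fun m hm => ?_
        rw [Finset.mem_Icc] at hm
        rw [vTail, if_neg (by omega)]
      · exact Finset.Icc_subset_Icc le_rfl (by omega)
      · intro m hm hm'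
        rw [Finset.mem_Icc] at hm hm'
        rw [uCoeff_of_lt (n := n - m) (by omega), mul_zero]
    have e2 : ∑ m ∈ Finset.Icc 1 (n - 1),
          ∑ l ∈ Finset.Icc (max 1 (k + m - n)) (min m (k - 1)),
            uCoeff m l * uCoeff (n - m) (k - l) = ∑ p ∈ antidiagonal n,
        ∑ q ∈ antidiagonal k, uCoeff p.1 q.1 * uCoeff p.2 q.2 := by
      rw [← sum_Icc_eq_sum_antidiagonal
        (fun a b => ∑ q ∈ antidiagonal k, uCoeff a q.1 * uCoeff b q.2)
        (by simp [uCoeff_zero_left]) (by simp [uCoeff_zero_left])]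
      refine Finset.sum_congr rfl fun m hm => ?_
      rw [Finset.mem_Icc] at hm
      rw [Finset.Nat.sum_antidiagonal_eq_sum_range_succ
        (fun i j => uCoeff m i * uCoeff (n - m) j)]
      apply Finset.sum_subset
      · intro l hl
        simp only [Finset.mem_Icc, Finset.mem_range] at hl ⊢
        omega
      · intro l hl hl'
        simp only [Finset.mem_Icc, Finset.mem_range] at hl hl'
        rcases Nat.eq_zero_or_pos l with rfl | h
        · rw [uCoeff_zero_right, zero_mul]
        by_cases h1 : m < l
        · rw [uCoeff_of_lt h1, zero_mul]
        by_cases h2 : l = k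
        · rw [h2, Nat.sub_self, uCoeff_zero_right, mul_zero]
        · rw [uCoeff_of_lt (n := n - m) (by omega), mul_zero]
    have e3 : ∑ m ∈ Finset.Icc 1 (n - 1),
          ∑ l ∈ Finset.Icc 1 (min m (n - m - k)), uCoeff m l * uCoeff (n - m) (k + l) =
        ∑ p ∈ antidiagonal n, ∑ l ∈ Finset.range (M + 1),
          uCoeff p.1 l * uCoeff p.2 (k + l) := by
      rw [← sum_Icc_eq_sum_antidiagonal
        (fun a b => ∑ l ∈ Finset.range (M + 1), uCoeff a l * uCoeff b (k + l))
        (by simp [uCoeff_zero_left]) (by simp [uCoeff_zero_left])]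
      refine Finset.sum_congr rfl fun m hm => ?_
      rw [Finset.mem_Icc] at hm
      exact sum_Icc_uCoeff_mul m n k M hM (by omega)
    rwa [e1, e2, e3] at h

/-! ### The majorant -/

/-- The majorant of `∑ n, |u_{n,k}| / 4 ^ n`, a rescaled sequence of Catalan numbers. -/
noncomputable def majorant : ℕ → ℝ
  | 0 => 0
  | k + 1 => 1 / 4 * (1 / 5) ^ k * catalan k

theorem majorant_nonneg (k : ℕ) : 0 ≤ majorant k := by
  cases k with
  | zero => simp [majorant]
  | succ k => rw [majorant]; positivity

theorem majorant_one : majorant 1 = 1 / 4 := by simp [majorant]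

/-- This is Segner's recursion for the Catalan numbers; `5/4` is the quotient of `(1/4)^2 (1/5)^k`
by `(1/4) (1/5)^(k+1)`. -/
theorem sum_antidiagonal_majorant (k : ℕ) :
    ∑ q ∈ antidiagonal (k + 2), majorant q.1 * majorant q.2 =
      5 / 4 * majorant (k + 2) := by
  rw [Finset.Nat.sum_antidiagonal_succ, Finset.Nat.sum_antidiagonal_succ']
  simp only [majorant, zero_mul, mul_zero, zero_add]
  rw [catalan_succ']
  push_cast
  rw [Finset.mul_sum, Finset.mul_sum]
  refine Finset.sum_congr rfl fun q hq => ?_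
  rw [mem_antidiagonal] at hq
  rw [← hq]
  ring

/-- Follows from `(n + 2) C_{n+1} = (4 n + 2) C_n`. -/
theorem catalan_succ_le (n : ℕ) : catalan (n + 1) ≤ 4 * catalan n := by
  have h1 := succ_mul_catalan_eq_centralBinom n
  have h2 := succ_mul_catalan_eq_centralBinom (n + 1)
  have h3 := Nat.succ_mul_centralBinom_succ n
  rw [← h1, ← h2] at h3
  have h4 : (n + 1) * ((n + 2) * catalan (n + 1)) = (n + 1) * ((4 * n + 2) * catalan n) := by
    linarith
  have h5 := Nat.eq_of_mul_eq_mul_left (Nat.succ_pos n) h4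
  have h6 : (n + 2) * catalan (n + 1) ≤ (n + 2) * (4 * catalan n) := by
    rw [h5]; nlinarith [Nat.zero_le (catalan n)]
  exact Nat.le_of_mul_le_mul_left h6 (by omega)

theorem majorant_succ_le (k : ℕ) : majorant (k + 2) ≤ 4 / 5 * majorant (k + 1) := by
  have h : (catalan (k + 1) : ℝ) ≤ 4 * catalan k := by exact_mod_cast catalan_succ_le k
  simp only [majorant]
  calc 1 / 4 * (1 / 5 : ℝ) ^ (k + 1) * catalan (k + 1)
      ≤ 1 / 4 * (1 / 5 : ℝ) ^ (k + 1) * (4 * catalan k) := by gcongr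
    _ = _ := by ring

theorem majorant_add_le (k l : ℕ) : majorant (k + 1 + l) ≤ (4 / 5) ^ l * majorant (k + 1) := by
  induction l with
  | zero => simp
  | succ l ih =>
    have := majorant_succ_le (k + l)
    rw [show k + 1 + (l + 1) = k + l + 2 by ring, pow_succ]
    rw [show k + 1 + l = k + l + 1 by ring] at ih
    linarith

theorem majorant_le (k : ℕ) : majorant k ≤ (4 / 5) ^ k := by
  cases k with
  | zero => simp [majorant]
  | succ k =>
    have h := majorant_add_le 0 k
    rw [zero_add, majorant_one, add_comm] at h
    have : (0 : ℝ) < (4 / 5) ^ k := by positivity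
    rw [pow_succ]
    linarith

/-- The generating function satisfies `G(z) = z/4 + (4/5) G(z)^2`, and at `z = 4/5` the smaller root
is `1/4`. The partial sums obey `G_{M+1} ≤ 1/5 + (4/5) G_M^2`, which preserves the bound `1/4`. -/
theorem sum_majorant_mul_pow_le (M : ℕ) :
    ∑ l ∈ Finset.range M, majorant l * (4 / 5) ^ l ≤ 1 / 4 := by
  induction M with
  | zero => simp
  | succ M ih =>
    have hG : 0 ≤ ∑ l ∈ Finset.range M, majorant l * (4 / 5) ^ l :=
      Finset.sum_nonneg fun l _ => mul_nonneg (majorant_nonneg l) (by positivity)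
    have h := sum_range_antidiagonal_le (f := fun l => majorant l * (4 / 5) ^ l)
      (g := fun l => majorant l * (4 / 5) ^ l)
      (fun l => mul_nonneg (majorant_nonneg l) (by positivity))
      (fun l => mul_nonneg (majorant_nonneg l) (by positivity))
      (by simp [majorant]) (by simp [majorant]) M
    have key : ∀ n, majorant n * (4 / 5) ^ n ≤ (if n = 1 then 1 / 5 else 0) + 4 / 5 *
        ∑ p ∈ antidiagonal n, majorant p.1 * (4 / 5) ^ p.1 *
          (majorant p.2 * (4 / 5) ^ p.2) := by
      intro n
      have hs : 0 ≤ ∑ p ∈ antidiagonal n, majorant p.1 * (4 / 5) ^ p.1 *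
          (majorant p.2 * (4 / 5) ^ p.2) := Finset.sum_nonneg fun p _ => by
        have := majorant_nonneg p.1
        have := majorant_nonneg p.2
        positivity
      match n with
      | 0 => simp [majorant]
      | 1 => rw [majorant_one, if_pos rfl]; linarith
      | k + 2 =>
        have e : ∑ p ∈ antidiagonal (k + 2), majorant p.1 * (4 / 5) ^ p.1 *
            (majorant p.2 * (4 / 5) ^ p.2) = (4 / 5) ^ (k + 2) *
            ∑ p ∈ antidiagonal (k + 2), majorant p.1 * majorant p.2 := by
          rw [Finset.mul_sum]
          refine Finset.sum_congr rfl fun p hp => ?_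
          rw [mem_antidiagonal] at hp
          rw [← hp]; ring
        rw [e, sum_antidiagonal_majorant, if_neg (by omega)]
        apply le_of_eq; ring
    have h1 : ∑ n ∈ Finset.range (M + 1), (if n = 1 then (1 / 5 : ℝ) else 0) ≤ 1 / 5 := by
      rw [Finset.sum_ite_eq']
      split_ifs <;> norm_num
    have h2 := Finset.sum_le_sum fun n (_ : n ∈ Finset.range (M + 1)) => key n
    rw [Finset.sum_add_distrib, ← Finset.mul_sum] at h2
    nlinarith

end BurgersHilbert

/-! ### Domination of the coefficients by the majorant -/

namespace BurgersHilbert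

/-- `|u_{n,k}|`, scaled by the radius `1 / 4`. -/
noncomputable def uAbs (n k : ℕ) : ℝ := |uCoeff n k| * (1 / 4) ^ n

/-- `|v_n|` for `n ≥ 1`, scaled by the radius `1 / 4`. -/
noncomputable def vAbs (n : ℕ) : ℝ := |vTail n| * (1 / 4) ^ n

theorem uAbs_nonneg (n k : ℕ) : 0 ≤ uAbs n k := by unfold uAbs; positivity

theorem vAbs_nonneg (n : ℕ) : 0 ≤ vAbs n := by unfold vAbs; positivity

theorem uAbs_zero_left (k : ℕ) : uAbs 0 k = 0 := by simp [uAbs, uCoeff_zero_left]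

theorem vAbs_zero : vAbs 0 = 0 := by simp [vAbs, vTail_zero]

theorem abs_mul_abs_mul_pow {n : ℕ} {p : ℕ × ℕ} (hp : p ∈ antidiagonal n) (x y : ℝ) :
    |x * y| * (1 / 4) ^ n = |x| * (1 / 4) ^ p.1 * (|y| * (1 / 4) ^ p.2) := by
  rw [mem_antidiagonal] at hp
  rw [← hp, abs_mul]; ring

/-- The constant is `2 = (1/2) * 4`: the products have total order `n + 1`, one more factor `1/4`
than in `vAbs n`. -/
theorem vAbs_le (n M : ℕ) (hM : n + 1 ≤ M) :
    vAbs n ≤ 2 * ∑ p ∈ antidiagonal (n + 1), ∑ l ∈ Finset.range (M + 1),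
      uAbs p.1 l * uAbs p.2 (1 + l) := by
  have h : |vTail n| ≤ (1 / 2) * ∑ p ∈ antidiagonal (n + 1), ∑ l ∈ Finset.range (M + 1),
      |uCoeff p.1 l * uCoeff p.2 (1 + l)| := by
    rw [vTail_eq n M hM, abs_mul, abs_of_pos (by norm_num : (0 : ℝ) < 1 / 2)]
    gcongr
    exact (Finset.abs_sum_le_sum_abs _ _).trans
      (Finset.sum_le_sum fun p _ => Finset.abs_sum_le_sum_abs _ _)
  have e : ∑ p ∈ antidiagonal (n + 1), ∑ l ∈ Finset.range (M + 1), uAbs p.1 l * uAbs p.2 (1 + l) =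
      (∑ p ∈ antidiagonal (n + 1), ∑ l ∈ Finset.range (M + 1),
        |uCoeff p.1 l * uCoeff p.2 (1 + l)|) * (1 / 4) ^ (n + 1) := by
    rw [Finset.sum_mul]
    refine Finset.sum_congr rfl fun p hp => ?_
    rw [Finset.sum_mul]
    exact Finset.sum_congr rfl fun l _ => (abs_mul_abs_mul_pow hp _ _).symm
  rw [e, vAbs, pow_succ]
  have := mul_le_mul_of_nonneg_right h (by positivity : (0 : ℝ) ≤ (1 / 4) ^ n)
  linarith

theorem uAbs_le (n k M : ℕ) (hM : n ≤ M) (hk : 1 ≤ k) :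
    ((k : ℝ) - 1) * uAbs n k ≤
      k * ∑ p ∈ antidiagonal n, vAbs p.1 * uAbs p.2 k
      + (k / 4) * ∑ p ∈ antidiagonal n, ∑ q ∈ antidiagonal k, uAbs p.1 q.1 * uAbs p.2 q.2
      + (k / 2) * ∑ p ∈ antidiagonal n, ∑ l ∈ Finset.range (M + 1),
          uAbs p.1 l * uAbs p.2 (k + l) := by
  have hk1 : (0 : ℝ) ≤ (k : ℝ) - 1 := by
    have : (1 : ℝ) ≤ k := by exact_mod_cast hk
    linarith
  have h := uCoeff_rec_antidiagonal n k M hM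
  have e1 : ∑ p ∈ antidiagonal n, vAbs p.1 * uAbs p.2 k =
      (∑ p ∈ antidiagonal n, |vTail p.1 * uCoeff p.2 k|) * (1 / 4) ^ n := by
    rw [Finset.sum_mul]
    exact Finset.sum_congr rfl fun p hp => (abs_mul_abs_mul_pow hp _ _).symm
  have e2 : ∑ p ∈ antidiagonal n, ∑ q ∈ antidiagonal k, uAbs p.1 q.1 * uAbs p.2 q.2 =
      (∑ p ∈ antidiagonal n, ∑ q ∈ antidiagonal k, |uCoeff p.1 q.1 * uCoeff p.2 q.2|)
        * (1 / 4) ^ n := by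
    rw [Finset.sum_mul]
    refine Finset.sum_congr rfl fun p hp => ?_
    rw [Finset.sum_mul]
    exact Finset.sum_congr rfl fun l _ => (abs_mul_abs_mul_pow hp _ _).symm
  have e3 : ∑ p ∈ antidiagonal n, ∑ l ∈ Finset.range (M + 1), uAbs p.1 l * uAbs p.2 (k + l) =
      (∑ p ∈ antidiagonal n, ∑ l ∈ Finset.range (M + 1),
        |uCoeff p.1 l * uCoeff p.2 (k + l)|) * (1 / 4) ^ n := by
    rw [Finset.sum_mul]
    refine Finset.sum_congr rfl fun p hp => ?_
    rw [Finset.sum_mul]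
    exact Finset.sum_congr rfl fun l _ => (abs_mul_abs_mul_pow hp _ _).symm
  have b1 := Finset.abs_sum_le_sum_abs (fun p : ℕ × ℕ => vTail p.1 * uCoeff p.2 k)
    (antidiagonal n)
  have b2 : |∑ p ∈ antidiagonal n, ∑ q ∈ antidiagonal k, uCoeff p.1 q.1 * uCoeff p.2 q.2| ≤
      ∑ p ∈ antidiagonal n, ∑ q ∈ antidiagonal k, |uCoeff p.1 q.1 * uCoeff p.2 q.2| :=
    (Finset.abs_sum_le_sum_abs _ _).trans
      (Finset.sum_le_sum fun p _ => Finset.abs_sum_le_sum_abs _ _)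
  have b3 : |∑ p ∈ antidiagonal n, ∑ l ∈ Finset.range (M + 1), uCoeff p.1 l * uCoeff p.2 (k + l)| ≤
      ∑ p ∈ antidiagonal n, ∑ l ∈ Finset.range (M + 1), |uCoeff p.1 l * uCoeff p.2 (k + l)| :=
    (Finset.abs_sum_le_sum_abs _ _).trans
      (Finset.sum_le_sum fun p _ => Finset.abs_sum_le_sum_abs _ _)
  rw [e1, e2, e3, uAbs]
  generalize ∑ p ∈ antidiagonal n, vTail p.1 * uCoeff p.2 k = X at *
  generalize ∑ p ∈ antidiagonal n, ∑ q ∈ antidiagonal k, uCoeff p.1 q.1 * uCoeff p.2 q.2 = Y at *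
  generalize ∑ p ∈ antidiagonal n, ∑ l ∈ Finset.range (M + 1),
    uCoeff p.1 l * uCoeff p.2 (k + l) = Z at *
  have hu : ((k : ℝ) - 1) * |uCoeff n k| ≤ k * |X| + (k / 4) * |Y| + (k / 2) * |Z| := by
    rw [← abs_of_nonneg hk1, ← abs_mul,
      show ((k : ℝ) - 1) * uCoeff n k = k * X + -((k / 4) * Y) + -((k / 2) * Z) by linarith]
    refine (abs_add_three _ _ _).trans (le_of_eq ?_)
    rw [abs_neg, abs_neg, abs_mul, abs_mul, abs_mul, Nat.abs_cast,
      abs_of_nonneg (by positivity : (0 : ℝ) ≤ k / 4),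
      abs_of_nonneg (by positivity : (0 : ℝ) ≤ k / 2)]
  have hu' : ((k : ℝ) - 1) * |uCoeff n k| ≤ k * (∑ p ∈ antidiagonal n, |vTail p.1 * uCoeff p.2 k|)
      + (k / 4) * (∑ p ∈ antidiagonal n, ∑ q ∈ antidiagonal k, |uCoeff p.1 q.1 * uCoeff p.2 q.2|)
      + (k / 2) * ∑ p ∈ antidiagonal n, ∑ l ∈ Finset.range (M + 1),
        |uCoeff p.1 l * uCoeff p.2 (k + l)| := by
    refine hu.trans ?_
    gcongr
  have := mul_le_mul_of_nonneg_right hu' (by positivity : (0 : ℝ) ≤ (1 / 4) ^ n)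
  linarith

/-- For `l ≥ 1` the decay from index 2 gives `A_{l+1} ≤ (4/5)^(l-1) A_2`, and `A_2 = 1/20 =
(1/16)(4/5)`. -/
theorem majorant_mul_majorant_succ_le (l : ℕ) :
    majorant l * majorant (1 + l) ≤ 1 / 16 * (majorant l * (4 / 5) ^ l) := by
  cases l with
  | zero => simp [majorant]
  | succ j =>
    have h := majorant_add_le 1 j
    have h2 : majorant 2 = 1 / 20 := by simp [majorant]; norm_num
    rw [show 1 + 1 + j = 1 + (j + 1) by ring, show (1 : ℕ) + 1 = 2 from rfl, h2] at h
    have := mul_le_mul_of_nonneg_left h (majorant_nonneg (j + 1))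
    rw [pow_succ]
    linarith

theorem sum_sum_antidiagonal_uAbs_le {N : ℕ}
    (ih : ∀ k, ∑ n ∈ Finset.range N, uAbs n k ≤ majorant k) (i j : ℕ) :
    ∑ n ∈ Finset.range (N + 1), ∑ p ∈ antidiagonal n, uAbs p.1 i * uAbs p.2 j ≤
      majorant i * majorant j :=
  (sum_range_antidiagonal_le (fun n => uAbs_nonneg n i) (fun n => uAbs_nonneg n j)
    (uAbs_zero_left i) (uAbs_zero_left j) N).trans
    (mul_le_mul (ih i) (ih j) (Finset.sum_nonneg fun n _ => uAbs_nonneg n j) (majorant_nonneg i))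

/-- The bound is `2 * (1/16) * (1/4)`, from `vAbs_le`, `majorant_mul_majorant_succ_le` and
`sum_majorant_mul_pow_le`. -/
theorem sum_vAbs_le_of_uAbs {N : ℕ} (ih : ∀ k, ∑ n ∈ Finset.range N, uAbs n k ≤ majorant k) :
    ∑ n ∈ Finset.range N, vAbs n ≤ 1 / 32 := by
  have h1 : ∑ n ∈ Finset.range N, vAbs n ≤ ∑ n ∈ Finset.range N,
      2 * ∑ p ∈ antidiagonal (n + 1), ∑ l ∈ Finset.range (N + 1),
        uAbs p.1 l * uAbs p.2 (1 + l) :=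
    Finset.sum_le_sum fun n hn => vAbs_le n N (by rw [Finset.mem_range] at hn; omega)
  have h2 : ∑ n ∈ Finset.range (N + 1), ∑ p ∈ antidiagonal n, ∑ l ∈ Finset.range (N + 1),
        uAbs p.1 l * uAbs p.2 (1 + l) = ∑ l ∈ Finset.range (N + 1),
      ∑ n ∈ Finset.range (N + 1), ∑ p ∈ antidiagonal n, uAbs p.1 l * uAbs p.2 (1 + l) := by
    rw [Finset.sum_comm]
    exact Finset.sum_congr rfl fun n _ => Finset.sum_comm
  have h3 := Finset.sum_le_sum fun l (_ : l ∈ Finset.range (N + 1)) =>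
    (sum_sum_antidiagonal_uAbs_le ih l (1 + l)).trans (majorant_mul_majorant_succ_le l)
  -- Splitting off the order-0 term, which is zero, aligns the orders `n + 1` of the bound for
  -- `v_n`.
  rw [← Finset.mul_sum, ← h2, Finset.sum_range_succ'] at h3
  have h4 := sum_majorant_mul_pow_le (N + 1)
  rw [← Finset.mul_sum] at h1
  simp [uAbs_zero_left] at h3 h4 h1 ⊢
  linarith

/-- The series `∑ n, |u_{n,k}| / 4 ^ n` is bounded by the majorant. -/
theorem sum_uAbs_le (N : ℕ) : ∀ k, ∑ n ∈ Finset.range N, uAbs n k ≤ majorant k := by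
  induction N with
  | zero => simpa using majorant_nonneg
  | succ N ih =>
    intro k
    match k with
    | 0 => simp [uAbs, uCoeff_zero_right, majorant]
    -- The recurrence gives nothing at `k = 1`, but `u_{n,1}` is known explicitly; this fixes the
    -- factor `1/4` in the majorant.
    | 1 =>
      rw [majorant_one]
      have : ∀ n, uAbs n 1 = if n = 1 then 1 / 4 else 0 := by
        intro n
        rw [uAbs, uCoeff_one_right]
        split_ifs with h <;> simp [h]
      simp only [this, Finset.sum_ite_eq']
      split_ifs <;> norm_num
    | j + 2 =>
      obtain ⟨k, hk⟩ : ∃ k, k = j + 2 := ⟨_, rfl⟩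
      rw [← hk]
      have h1 := Finset.sum_le_sum fun n (hn : n ∈ Finset.range (N + 1)) =>
        uAbs_le n k N (by rw [Finset.mem_range] at hn; omega) (by omega)
      rw [Finset.sum_add_distrib, Finset.sum_add_distrib, ← Finset.mul_sum, ← Finset.mul_sum,
        ← Finset.mul_sum, ← Finset.mul_sum] at h1
      have b1 : ∑ n ∈ Finset.range (N + 1), ∑ p ∈ antidiagonal n, vAbs p.1 * uAbs p.2 k ≤
          1 / 32 * majorant k :=
        (sum_range_antidiagonal_le vAbs_nonneg (fun n => uAbs_nonneg n k) vAbs_zero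
          (uAbs_zero_left k) N).trans
          (mul_le_mul (sum_vAbs_le_of_uAbs ih) (ih k)
            (Finset.sum_nonneg fun n _ => uAbs_nonneg n k) (by norm_num))
      have b2 : ∑ n ∈ Finset.range (N + 1), ∑ p ∈ antidiagonal n, ∑ q ∈ antidiagonal k,
          uAbs p.1 q.1 * uAbs p.2 q.2 ≤ 5 / 4 * majorant k := by
        rw [hk, ← sum_antidiagonal_majorant j]
        have e : ∑ n ∈ Finset.range (N + 1), ∑ p ∈ antidiagonal n, ∑ q ∈ antidiagonal (j + 2),
            uAbs p.1 q.1 * uAbs p.2 q.2 = ∑ q ∈ antidiagonal (j + 2),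
            ∑ n ∈ Finset.range (N + 1), ∑ p ∈ antidiagonal n, uAbs p.1 q.1 * uAbs p.2 q.2 := by
          rw [Finset.sum_comm]
          exact Finset.sum_congr rfl fun n _ => Finset.sum_comm
        rw [e]
        exact Finset.sum_le_sum fun q _ => sum_sum_antidiagonal_uAbs_le ih q.1 q.2
      have b3 : ∑ n ∈ Finset.range (N + 1), ∑ p ∈ antidiagonal n, ∑ l ∈ Finset.range (N + 1),
          uAbs p.1 l * uAbs p.2 (k + l) ≤ 1 / 4 * majorant k := by
        have e : ∑ n ∈ Finset.range (N + 1), ∑ p ∈ antidiagonal n, ∑ l ∈ Finset.range (N + 1),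
            uAbs p.1 l * uAbs p.2 (k + l) = ∑ l ∈ Finset.range (N + 1),
            ∑ n ∈ Finset.range (N + 1), ∑ p ∈ antidiagonal n, uAbs p.1 l * uAbs p.2 (k + l) := by
          rw [Finset.sum_comm]
          exact Finset.sum_congr rfl fun n _ => Finset.sum_comm
        rw [e]
        calc _ ≤ ∑ l ∈ Finset.range (N + 1), majorant l * (4 / 5) ^ l * majorant k := by
              refine Finset.sum_le_sum fun l _ => (sum_sum_antidiagonal_uAbs_le ih l _).trans ?_
              rw [hk, mul_assoc]
              exact mul_le_mul_of_nonneg_left (majorant_add_le (j + 1) l) (majorant_nonneg l)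
          _ ≤ _ := by
              rw [← Finset.sum_mul]
              exact mul_le_mul_of_nonneg_right (sum_majorant_mul_pow_le _) (majorant_nonneg k)
      have hk2 : (2 : ℝ) ≤ k := by rw [hk]; push_cast; linarith [(Nat.cast_nonneg j : (0 : ℝ) ≤ j)]
      have hA := majorant_nonneg k
      have h2 : ((k : ℝ) - 1) * ∑ n ∈ Finset.range (N + 1), uAbs n k ≤
          k * (1 / 32 * majorant k) + (k / 4) * (5 / 4 * majorant k)
            + (k / 2) * (1 / 4 * majorant k) := by
        refine h1.trans ?_
        gcongr
      refine le_of_mul_le_mul_left (h2.trans ?_) (by linarith : (0 : ℝ) < k - 1)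
      -- The coefficient is `k (1/32 + 5/16 + 1/8) = 15 k / 32`, at most `k - 1` since `k ≥ 2`.
      nlinarith

theorem sum_vAbs_le (N : ℕ) : ∑ n ∈ Finset.range N, vAbs n ≤ 1 / 32 :=
  sum_vAbs_le_of_uAbs (sum_uAbs_le N)

/-- A weighted `ℓ¹` norm of the coefficients of `u_n`, which controls `u_n` and `u_n'`. -/
noncomputable def uNorm (n : ℕ) : ℝ := ∑ k ∈ Finset.range (n + 1), (k + 1) * |uCoeff n k|

theorem uNorm_nonneg (n : ℕ) : 0 ≤ uNorm n := Finset.sum_nonneg fun k _ => by positivity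

/-- Interchanging the finite sums over `n` and `k` bounds the partial sums by `∑ (k+1) A_k`, finite
because `A_k ≤ (4/5)^k`. -/
theorem summable_uNorm {r : ℝ} (hr : 0 ≤ r) (hr' : r ≤ 1 / 4) :
    Summable fun n => uNorm n * r ^ n := by
  have hsum : Summable fun k : ℕ => ((k : ℝ) + 1) * majorant k := by
    have h1 := summable_pow_mul_geometric_of_norm_lt_one (R := ℝ) (r := 4 / 5) 1
      (by rw [Real.norm_of_nonneg] <;> norm_num)
    have h0 := summable_geometric_of_lt_one (r := (4 / 5 : ℝ)) (by norm_num) (by norm_num)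
    refine Summable.of_nonneg_of_le (fun k => mul_nonneg (by positivity) (majorant_nonneg k))
      (fun k => ?_) (h1.add h0)
    have := mul_le_mul_of_nonneg_left (majorant_le k) (by positivity : (0 : ℝ) ≤ (k : ℝ) + 1)
    simp only [pow_one]
    linarith
  have h : Summable fun n => uNorm n * (1 / 4) ^ n := by
    refine summable_of_sum_range_le (c := ∑' k : ℕ, ((k : ℝ) + 1) * majorant k)
      (fun n => mul_nonneg (uNorm_nonneg n) (by positivity)) fun N => ?_
    calc ∑ n ∈ Finset.range N, uNorm n * (1 / 4) ^ n
        = ∑ n ∈ Finset.range N, ∑ k ∈ Finset.range N, ((k : ℝ) + 1) * uAbs n k := by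
          refine Finset.sum_congr rfl fun n hn => ?_
          rw [Finset.mem_range] at hn
          rw [uNorm, Finset.sum_mul]
          rw [Finset.sum_subset (Finset.range_subset_range.2 hn : Finset.range (n + 1) ⊆ _)]
          · exact Finset.sum_congr rfl fun k _ => by rw [uAbs]; ring
          · intro k _ hk
            rw [Finset.mem_range] at hk
            rw [uCoeff_of_lt (by omega)]; simp
      _ = ∑ k ∈ Finset.range N, ((k : ℝ) + 1) * ∑ n ∈ Finset.range N, uAbs n k := by
          rw [Finset.sum_comm]
          exact Finset.sum_congr rfl fun k _ => by rw [Finset.mul_sum]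
      _ ≤ ∑ k ∈ Finset.range N, ((k : ℝ) + 1) * majorant k :=
          Finset.sum_le_sum fun k _ => mul_le_mul_of_nonneg_left (sum_uAbs_le N k) (by positivity)
      _ ≤ _ := hsum.sum_le_tsum _ fun k _ => mul_nonneg (by positivity) (majorant_nonneg k)
  refine Summable.of_nonneg_of_le (fun n => mul_nonneg (uNorm_nonneg n) (by positivity))
    (fun n => ?_) h
  exact mul_le_mul_of_nonneg_left (by gcongr) (uNorm_nonneg n)

theorem summable_vCoeff {r : ℝ} (hr : 0 ≤ r) (hr' : r ≤ 1 / 4) :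
    Summable fun n => |vCoeff n| * r ^ n := by
  have h : Summable vAbs := summable_of_sum_range_le vAbs_nonneg sum_vAbs_le
  -- The index 0 is dropped because `vTail 0 = 0` whereas `v_0 = -1`.
  rw [← summable_nat_add_iff 1] at h ⊢
  refine Summable.of_nonneg_of_le (fun n => by positivity) (fun n => ?_) h
  rw [vAbs, vTail, if_neg (by omega)]
  gcongr

end BurgersHilbert

/-! ### A product formula for trigonometric polynomials -/

theorem sum_range_mul_sum_antidiagonal (N : ℕ) (f : ℕ → ℝ) (c : ℕ → ℕ → ℝ)
    (hc : ∀ i j, N < i + j → c i j = 0) :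
    ∑ k ∈ Finset.range (N + 1), f k * ∑ q ∈ antidiagonal k, c q.1 q.2 =
      ∑ i ∈ Finset.range (N + 1), ∑ j ∈ Finset.range (N + 1), c i j * f (i + j) := by
  rw [← Finset.sum_product' (f := fun i j => c i j * f (i + j))]
  rw [← Finset.sum_filter_of_ne (p := fun x : ℕ × ℕ => x.1 + x.2 ∈ Finset.range (N + 1))]
  · rw [← Finset.sum_fiberwise_of_maps_to (s := Finset.filter _ _) (t := Finset.range (N + 1))
      (g := fun x : ℕ × ℕ => x.1 + x.2) (by intro x hx; exact (Finset.mem_filter.1 hx).2)]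
    refine Finset.sum_congr rfl fun k hk => ?_
    rw [Finset.mul_sum]
    refine Finset.sum_congr ?_ fun q hq => ?_
    · ext ⟨i, j⟩
      simp only [mem_antidiagonal, Finset.mem_filter, Finset.mem_product, Finset.mem_range] at hk ⊢
      omega
    · rw [(Finset.mem_filter.1 hq).2]; ring
  · rintro ⟨i, j⟩ _ h
    rw [Finset.mem_range]
    by_contra h'
    exact h (by rw [hc i j (by simp only at h'; omega), zero_mul])

theorem sum_range_mul_sum_shift (N : ℕ) (f : ℕ → ℝ) (c : ℕ → ℕ → ℝ)
    (hc : ∀ i j, N < i + j → c i j = 0) :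
    ∑ k ∈ Finset.range (N + 1), f k * ∑ l ∈ Finset.range (N + 1), c l (k + l) =
      ∑ i ∈ Finset.range (N + 1), ∑ j ∈ Finset.range (N + 1),
        if i ≤ j then c i j * f (j - i) else 0 := by
  simp_rw [Finset.mul_sum]
  rw [Finset.sum_comm]
  refine Finset.sum_congr rfl fun l hl => ?_
  rw [Finset.mem_range] at hl
  rw [← Finset.sum_filter]
  have e : (Finset.range (N + 1)).filter (fun j => l ≤ j) = Finset.Ico l (N + 1) := by
    ext j; simp only [Finset.mem_filter, Finset.mem_range, Finset.mem_Ico]; omega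
  rw [e, Finset.sum_Ico_eq_sum_range]
  symm
  rw [← Finset.sum_subset (Finset.range_subset_range.2 (by omega : N + 1 - l ≤ N + 1))]
  · refine Finset.sum_congr rfl fun k _ => ?_
    rw [Nat.add_sub_cancel_left, add_comm l k, mul_comm]
  · intro k _ hk
    rw [Finset.mem_range] at hk
    rw [hc _ _ (by omega), mul_zero]

/-- Symmetrizing in `i, j` turns each product into half of `(i+j) sin((i+j)x) + (j-i) sin((j-i)x)`.
Grouping by `i + j` gives the convolution. The difference part is even in `j - i`, so it reduces to
`i ≤ j` and gives the correlation. -/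
theorem sum_cos_mul_sin_of_symm (N : ℕ) (c : ℕ → ℕ → ℝ) (hc : ∀ i j, N < i + j → c i j = 0)
    (hs : ∀ i j, c i j = c j i) (x : ℝ) :
    ∑ i ∈ Finset.range (N + 1), ∑ j ∈ Finset.range (N + 1),
        c i j * (Real.cos (i * x) * (j * Real.sin (j * x))) =
      ∑ k ∈ Finset.range (N + 1), (k / 4 * ∑ q ∈ antidiagonal k, c q.1 q.2
        + k / 2 * ∑ l ∈ Finset.range (N + 1), c l (k + l)) * Real.sin (k * x) := by
  have h1 := sum_range_mul_sum_antidiagonal N (fun k => k * Real.sin (k * x)) c hc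
  have h2 := sum_range_mul_sum_shift N (fun k => k * Real.sin (k * x)) c hc
  have h3 : 2 * ∑ i ∈ Finset.range (N + 1), ∑ j ∈ Finset.range (N + 1),
        (if i ≤ j then c i j * (((j - i : ℕ) : ℝ) * Real.sin (((j - i : ℕ) : ℝ) * x)) else 0) =
      ∑ i ∈ Finset.range (N + 1), ∑ j ∈ Finset.range (N + 1),
        c i j * (((j : ℝ) - i) * Real.sin (((j : ℝ) - i) * x)) := by
    rw [two_mul]
    nth_rewrite 2 [Finset.sum_comm]
    rw [← Finset.sum_add_distrib]
    refine Finset.sum_congr rfl fun i _ => ?_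
    rw [← Finset.sum_add_distrib]
    refine Finset.sum_congr rfl fun j _ => ?_
    rcases lt_trichotomy i j with h | h | h
    · rw [if_pos h.le, if_neg (by omega), Nat.cast_sub h.le, add_zero]
    · subst h; simp
    · rw [if_neg (by omega), if_pos h.le, Nat.cast_sub h.le, zero_add, hs j i]
      rw [show ((i : ℝ) - j) * x = -(((j : ℝ) - i) * x) by ring, Real.sin_neg]
      ring
  have h4 : 2 * ∑ i ∈ Finset.range (N + 1), ∑ j ∈ Finset.range (N + 1),
        c i j * (Real.cos (i * x) * (j * Real.sin (j * x))) =
      ∑ i ∈ Finset.range (N + 1), ∑ j ∈ Finset.range (N + 1),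
        (1 / 2 * (c i j * (((i + j : ℕ) : ℝ) * Real.sin (((i + j : ℕ) : ℝ) * x)))
          + 1 / 2 * (c i j * (((j : ℝ) - i) * Real.sin (((j : ℝ) - i) * x)))) := by
    rw [two_mul]
    nth_rewrite 2 [Finset.sum_comm]
    rw [← Finset.sum_add_distrib]
    refine Finset.sum_congr rfl fun i _ => ?_
    rw [← Finset.sum_add_distrib]
    refine Finset.sum_congr rfl fun j _ => ?_
    rw [hs j i]
    push_cast
    rw [add_mul (i : ℝ) j x, sub_mul (j : ℝ) i x, Real.sin_add, Real.sin_sub]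
    ring
  simp_rw [Finset.sum_add_distrib, ← Finset.mul_sum] at h4
  have h5 : ∑ k ∈ Finset.range (N + 1), (k / 4 * ∑ q ∈ antidiagonal k, c q.1 q.2
        + k / 2 * ∑ l ∈ Finset.range (N + 1), c l (k + l)) * Real.sin (k * x) =
      1 / 4 * ∑ k ∈ Finset.range (N + 1), (k * Real.sin (k * x)) * ∑ q ∈ antidiagonal k, c q.1 q.2
      + 1 / 2 * ∑ k ∈ Finset.range (N + 1), (k * Real.sin (k * x)) *
        ∑ l ∈ Finset.range (N + 1), c l (k + l) := by
    rw [Finset.mul_sum, Finset.mul_sum, ← Finset.sum_add_distrib]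
    exact Finset.sum_congr rfl fun k _ => by ring
  rw [h5, h1, h2]
  linarith

namespace BurgersHilbert

/-! ### The terms of the series -/

/-- The Hilbert transform of `u_n`. -/
noncomputable def hTerm (n : ℕ) (x : ℝ) : ℝ :=
  ∑ k ∈ Finset.range (n + 1), uCoeff n k * Real.sin (k * x)

/-- The derivative of `u_n`. -/
noncomputable def uTermDeriv (n : ℕ) (x : ℝ) : ℝ :=
  ∑ k ∈ Finset.range (n + 1), uCoeff n k * (-(k * Real.sin (k * x)))

theorem hasDerivAt_uTerm (n : ℕ) (x : ℝ) : HasDerivAt (uTerm n) (uTermDeriv n x) x := by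
  unfold uTerm uTermDeriv
  apply HasDerivAt.fun_sum
  intro k _
  apply HasDerivAt.const_mul
  have h := ((hasDerivAt_id x).const_mul (k : ℝ)).cos
  simp only [id_eq, mul_one] at h
  exact h.congr_deriv (by ring)

theorem deriv_uTerm (n : ℕ) : deriv (uTerm n) = uTermDeriv n :=
  funext fun x => (hasDerivAt_uTerm n x).deriv

theorem continuous_uTerm (n : ℕ) : Continuous (uTerm n) := by
  unfold uTerm; fun_prop

theorem continuous_uTermDeriv (n : ℕ) : Continuous (uTermDeriv n) := by
  unfold uTermDeriv; fun_prop

theorem continuous_hTerm (n : ℕ) : Continuous (hTerm n) := by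
  unfold hTerm; fun_prop

theorem abs_sum_le_uNorm (n : ℕ) (f : ℕ → ℝ) (hf : ∀ k, |f k| ≤ k + 1) :
    |∑ k ∈ Finset.range (n + 1), uCoeff n k * f k| ≤ uNorm n := by
  refine (Finset.abs_sum_le_sum_abs _ _).trans (Finset.sum_le_sum fun k _ => ?_)
  rw [abs_mul, mul_comm]
  exact mul_le_mul_of_nonneg_right (hf k) (abs_nonneg _)

theorem abs_uTerm_le (n : ℕ) (x : ℝ) : |uTerm n x| ≤ uNorm n :=
  abs_sum_le_uNorm n _ fun k => (Real.abs_cos_le_one _).trans (by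
    have : (0 : ℝ) ≤ k := Nat.cast_nonneg k
    linarith)

theorem abs_hTerm_le (n : ℕ) (x : ℝ) : |hTerm n x| ≤ uNorm n :=
  abs_sum_le_uNorm n _ fun k => (Real.abs_sin_le_one _).trans (by
    have : (0 : ℝ) ≤ k := Nat.cast_nonneg k
    linarith)

theorem abs_uTermDeriv_le (n : ℕ) (x : ℝ) : |uTermDeriv n x| ≤ uNorm n :=
  abs_sum_le_uNorm n _ fun k => by
    have h0 : (0 : ℝ) ≤ k := Nat.cast_nonneg k
    rw [abs_neg, abs_mul, Nat.abs_cast]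
    nlinarith [Real.abs_sin_le_one (k * x)]

theorem h1Norm_uTerm_le (n : ℕ) : h1Norm (uTerm n) ≤ Real.sqrt (4 * Real.pi) * uNorm n := by
  rw [h1Norm, deriv_uTerm]
  have h : ‖∫ x in (-Real.pi)..Real.pi, (uTerm n x ^ 2 + uTermDeriv n x ^ 2)‖ ≤
      (2 * uNorm n ^ 2) * |Real.pi - -Real.pi| := by
    refine intervalIntegral.norm_integral_le_of_norm_le_const fun x _ => ?_
    rw [Real.norm_of_nonneg (by positivity)]
    have h1 := sq_le_sq' (abs_le.1 (abs_uTerm_le n x)).1 (abs_le.1 (abs_uTerm_le n x)).2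
    have h2 := sq_le_sq' (abs_le.1 (abs_uTermDeriv_le n x)).1 (abs_le.1 (abs_uTermDeriv_le n x)).2
    linarith
  have e : Real.sqrt (4 * Real.pi) * uNorm n = Real.sqrt (4 * Real.pi * uNorm n ^ 2) := by
    rw [Real.sqrt_mul (by positivity) (uNorm n ^ 2), Real.sqrt_sq (uNorm_nonneg n)]
  rw [e]
  apply Real.sqrt_le_sqrt
  refine (Real.le_norm_self _).trans (h.trans (le_of_eq ?_))
  rw [sub_neg_eq_add, abs_of_pos (by positivity)]
  ring

theorem sum_range_eq_of_le {n M : ℕ} (hM : n ≤ M) (f : ℕ → ℝ) :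
    ∑ k ∈ Finset.range (n + 1), uCoeff n k * f k =
      ∑ k ∈ Finset.range (M + 1), uCoeff n k * f k := by
  apply Finset.sum_subset (Finset.range_subset_range.2 (by omega))
  intro k _ hk
  rw [Finset.mem_range] at hk
  rw [uCoeff_of_lt (by omega), zero_mul]

/-- The traveling wave equation, order by order in `ε`. -/
theorem wave_eq_term (n : ℕ) (x : ℝ) :
    hTerm n x - ∑ p ∈ antidiagonal n, vCoeff p.1 * uTermDeriv p.2 x
      + ∑ p ∈ antidiagonal n, uTerm p.1 x * uTermDeriv p.2 x = 0 := by
  have hle : ∀ p ∈ antidiagonal n, p.1 ≤ n ∧ p.2 ≤ n := by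
    intro p hp
    rw [mem_antidiagonal] at hp
    omega
  have h := sum_cos_mul_sin_of_symm n
    (fun i j => ∑ p ∈ antidiagonal n, uCoeff p.1 i * uCoeff p.2 j)
    (fun i j hij => Finset.sum_eq_zero fun p hp => by
      rw [mem_antidiagonal] at hp
      by_cases h1 : p.1 < i
      · rw [uCoeff_of_lt h1, zero_mul]
      · rw [uCoeff_of_lt (n := p.2) (by omega), mul_zero])
    (fun i j => by
      rw [← Finset.Nat.sum_antidiagonal_swap]
      exact Finset.sum_congr rfl fun p _ => by simp [mul_comm]) x
  have e1 : ∑ p ∈ antidiagonal n, uTerm p.1 x * uTermDeriv p.2 x =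
      -∑ i ∈ Finset.range (n + 1), ∑ j ∈ Finset.range (n + 1),
        (∑ p ∈ antidiagonal n, uCoeff p.1 i * uCoeff p.2 j)
          * (Real.cos (i * x) * (j * Real.sin (j * x))) := by
    simp_rw [Finset.sum_mul]
    rw [Finset.sum_congr rfl fun i _ => Finset.sum_comm, Finset.sum_comm, ← Finset.sum_neg_distrib]
    refine Finset.sum_congr rfl fun p hp => ?_
    rw [uTerm, uTermDeriv, sum_range_eq_of_le (hle p hp).1, sum_range_eq_of_le (hle p hp).2,
      Finset.sum_mul_sum, ← Finset.sum_neg_distrib]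
    refine Finset.sum_congr rfl fun i _ => ?_
    rw [← Finset.sum_neg_distrib]
    exact Finset.sum_congr rfl fun j _ => by ring
  have e2 : ∑ p ∈ antidiagonal n, vCoeff p.1 * uTermDeriv p.2 x =
      -∑ k ∈ Finset.range (n + 1),
        k * (-uCoeff n k + ∑ p ∈ antidiagonal n, vTail p.1 * uCoeff p.2 k)
          * Real.sin (k * x) := by
    -- Isolating `v_0 = -1` produces `-k u_{n,k}`, which joins the Hilbert transform's `u_{n,k}` to
    -- form `(1 - k) u_{n,k}`.
    have hv : ∀ m, vCoeff m = (if m = 0 then -1 else 0) + vTail m := by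
      intro m
      rw [vTail]
      split_ifs with h
      · rw [h, vCoeff_zero]; simp
      · simp
    have hsum : ∀ k, ∑ p ∈ antidiagonal n, vCoeff p.1 * uCoeff p.2 k =
        -uCoeff n k + ∑ p ∈ antidiagonal n, vTail p.1 * uCoeff p.2 k := by
      intro k
      simp_rw [hv, add_mul]
      rw [Finset.sum_add_distrib]
      congr 1
      rw [Finset.sum_eq_single (0, n)]
      · simp
      · rintro ⟨a, b⟩ hp hne
        rw [mem_antidiagonal] at hp
        have : a ≠ 0 := by
          rintro rfl
          apply hne
          simp only [Prod.mk.injEq, true_and]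
          omega
        simp [this]
      · simp
    simp_rw [← hsum, Finset.mul_sum, Finset.sum_mul]
    rw [Finset.sum_comm, ← Finset.sum_neg_distrib]
    refine Finset.sum_congr rfl fun p hp => ?_
    rw [uTermDeriv, sum_range_eq_of_le (hle p hp).2, Finset.mul_sum, ← Finset.sum_neg_distrib]
    exact Finset.sum_congr rfl fun j _ => by ring
  rw [e1, h, e2, hTerm, sub_neg_eq_add, ← Finset.sum_add_distrib,
    ← sub_eq_add_neg, ← Finset.sum_sub_distrib]
  refine Finset.sum_eq_zero fun k _ => ?_
  have hr := uCoeff_rec_antidiagonal n k n le_rfl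
  rw [Finset.sum_comm (s := antidiagonal k), Finset.sum_comm (s := Finset.range (n + 1))]
  linear_combination Real.sin (k * x) * hr

end BurgersHilbert

namespace BurgersHilbert

/-! ### Power series in `ε` with bounded continuous coefficients -/

instance : IsFiniteMeasure periodMeasure := by
  unfold periodMeasure; infer_instance

/-- The sum of `∑ n, F n x * ε ^ n`. -/
noncomputable def powerSum (F : ℕ → ℝ → ℝ) (ε : ℂ) (x : ℝ) : ℂ := ∑' n, (F n x : ℂ) * ε ^ n

section PowerSum

variable {F : ℕ → ℝ → ℝ} {b : ℕ → ℝ} {ε : ℂ}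

theorem norm_term_le (hb : ∀ n x, |F n x| ≤ b n) (n : ℕ) (x : ℝ) :
    ‖(F n x : ℂ) * ε ^ n‖ ≤ b n * ‖ε‖ ^ n := by
  rw [norm_mul, norm_pow, Complex.norm_real, Real.norm_eq_abs]
  exact mul_le_mul_of_nonneg_right (hb n x) (by positivity)

theorem summable_norm_term (hb : ∀ n x, |F n x| ≤ b n) (hs : Summable fun n => b n * ‖ε‖ ^ n)
    (x : ℝ) : Summable fun n => ‖(F n x : ℂ) * ε ^ n‖ :=
  Summable.of_nonneg_of_le (fun _ => norm_nonneg _) (fun n => norm_term_le hb n x) hs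

theorem hasSum_powerSum (hb : ∀ n x, |F n x| ≤ b n) (hs : Summable fun n => b n * ‖ε‖ ^ n)
    (x : ℝ) : HasSum (fun n => (F n x : ℂ) * ε ^ n) (powerSum F ε x) :=
  (summable_norm_term hb hs x).of_norm.hasSum

theorem continuous_powerSum (hF : ∀ n, Continuous (F n)) (hb : ∀ n x, |F n x| ≤ b n)
    (hs : Summable fun n => b n * ‖ε‖ ^ n) : Continuous (powerSum F ε) :=
  continuous_tsum (fun n => (Complex.continuous_ofReal.comp (hF n)).mul continuous_const) hs
    (norm_term_le hb)

theorem norm_powerSum_le (hb : ∀ n x, |F n x| ≤ b n) (hs : Summable fun n => b n * ‖ε‖ ^ n)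
    (x : ℝ) : ‖powerSum F ε x‖ ≤ ∑' n, b n * ‖ε‖ ^ n :=
  tsum_of_norm_bounded hs.hasSum fun n => norm_term_le hb n x

theorem memLp_powerSum (hF : ∀ n, Continuous (F n)) (hb : ∀ n x, |F n x| ≤ b n)
    (hs : Summable fun n => b n * ‖ε‖ ^ n) : MemLp (powerSum F ε) 2 periodMeasure :=
  MemLp.of_bound (continuous_powerSum hF hb hs).aestronglyMeasurable _
    (ae_of_all _ (norm_powerSum_le hb hs))

theorem tendsto_eLpNorm_powerSum (hb : ∀ n x, |F n x| ≤ b n)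
    (hs : Summable fun n => b n * ‖ε‖ ^ n) :
    Tendsto (fun N : ℕ => eLpNorm (fun x => (∑ n ∈ Finset.range N, (F n x : ℂ) * ε ^ n)
      - powerSum F ε x) 2 periodMeasure) atTop (𝓝 0) := by
  have hbound : ∀ N : ℕ, eLpNorm (fun x => (∑ n ∈ Finset.range N, (F n x : ℂ) * ε ^ n)
      - powerSum F ε x) 2 periodMeasure ≤ periodMeasure Set.univ ^ (2 : ENNReal).toReal⁻¹ *
        ENNReal.ofReal (∑' n, b (n + N) * ‖ε‖ ^ (n + N)) := by
    intro N
    refine eLpNorm_le_of_ae_bound (ae_of_all _ fun x => ?_)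
    have h := (summable_norm_term hb hs x).of_norm.sum_add_tsum_nat_add N
    rw [powerSum, ← h, sub_add_cancel_left, norm_neg]
    exact tsum_of_norm_bounded ((summable_nat_add_iff N).2 hs).hasSum
      fun n => norm_term_le hb (n + N) x
  refine tendsto_of_tendsto_of_tendsto_of_le_of_le tendsto_const_nhds ?_ (fun _ => zero_le) hbound
  have h := ENNReal.tendsto_ofReal (tendsto_sum_nat_add fun n => b n * ‖ε‖ ^ n)
  rw [ENNReal.ofReal_zero] at h
  have h' := ENNReal.Tendsto.const_mul (a := periodMeasure Set.univ ^ (2 : ENNReal).toReal⁻¹) h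
    (Or.inr (ENNReal.rpow_ne_top_of_nonneg (by simp) (measure_ne_top _ _)))
  rwa [mul_zero] at h'

theorem hasSum_fCoeff_powerSum (hF : ∀ n, Continuous (F n)) (hb : ∀ n x, |F n x| ≤ b n)
    (hs : Summable fun n => b n * ‖ε‖ ^ n) (k : ℤ) :
    HasSum (fun n => fCoeff (fun x => (F n x : ℂ)) k * ε ^ n) (fCoeff (powerSum F ε) k) := by
  have h : HasSum (fun n => ∫ x in (-Real.pi)..Real.pi,
      Complex.exp (-(Complex.I * k * x)) * ((F n x : ℂ) * ε ^ n))
      (∫ x in (-Real.pi)..Real.pi, Complex.exp (-(Complex.I * k * x)) * powerSum F ε x) := by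
    refine intervalIntegral.hasSum_integral_of_dominated_convergence
      (fun n _ => b n * ‖ε‖ ^ n) (fun n => ?_) (fun n => ?_) ?_ ?_ ?_
    · have := hF n
      exact Continuous.aestronglyMeasurable (by fun_prop)
    · refine ae_of_all _ fun x _ => ?_
      rw [norm_mul, show -(Complex.I * k * x) = ((-(k * x) : ℝ) : ℂ) * Complex.I by
        push_cast; ring, Complex.norm_exp_ofReal_mul_I, one_mul]
      exact norm_term_le hb n x
    · exact ae_of_all _ fun x _ => hs
    · exact intervalIntegrable_const
    · exact ae_of_all _ fun x _ => (hasSum_powerSum hb hs x).mul_left _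
  have e : ∀ n, fCoeff (fun x => (F n x : ℂ)) k * ε ^ n = 1 / (2 * Real.pi) *
      ∫ x in (-Real.pi)..Real.pi,
        Complex.exp (-(Complex.I * k * x)) * ((F n x : ℂ) * ε ^ n) := by
    intro n
    rw [fCoeff, mul_assoc, ← intervalIntegral.integral_mul_const]
    simp_rw [mul_assoc]
  simp_rw [e]
  exact h.mul_left _

theorem hasDerivAt_powerSum {F' : ℕ → ℝ → ℝ} (hd : ∀ n x, HasDerivAt (F n) (F' n x) x)
    (hb : ∀ n x, |F n x| ≤ b n) (hb' : ∀ n x, |F' n x| ≤ b n)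
    (hs : Summable fun n => b n * ‖ε‖ ^ n) (x : ℝ) :
    HasDerivAt (powerSum F ε) (powerSum F' ε x) x :=
  hasDerivAt_tsum (g := fun n x => (F n x : ℂ) * ε ^ n) (g' := fun n x => (F' n x : ℂ) * ε ^ n) hs
    (fun n y => (hd n y).ofReal_comp.mul_const _) (norm_term_le hb')
    (summable_norm_term hb hs 0).of_norm x

end PowerSum

/-! ### Fourier coefficients of the terms -/

theorem integral_exp_int (m : ℤ) :
    ∫ x in (-Real.pi)..Real.pi, Complex.exp (Complex.I * m * x) =
      if m = 0 then (2 * Real.pi : ℂ) else 0 := by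
  split_ifs with h
  · subst h
    simp
    ring
  · have hm : Complex.I * m ≠ 0 := mul_ne_zero Complex.I_ne_zero (by exact_mod_cast h)
    rw [integral_exp_mul_complex hm]
    have : Complex.exp (Complex.I * m * (Real.pi : ℝ)) =
        Complex.exp (Complex.I * m * ((-Real.pi : ℝ) : ℂ)) := by
      rw [Complex.exp_eq_exp_iff_exists_int]
      exact ⟨m, by push_cast; ring⟩
    rw [this, sub_self, zero_div]

theorem fCoeff_cos (j : ℕ) (k : ℤ) : fCoeff (fun x => (Real.cos (j * x) : ℂ)) k =
    1 / (2 * Real.pi) * (1 / 2 * ((if (j : ℤ) - k = 0 then (2 * Real.pi : ℂ) else 0)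
      + (if -(j : ℤ) - k = 0 then (2 * Real.pi : ℂ) else 0))) := by
  rw [fCoeff, ← integral_exp_int, ← integral_exp_int, ← intervalIntegral.integral_add,
    ← intervalIntegral.integral_const_mul (1 / 2 : ℂ)]
  · congr 2
    funext x
    push_cast
    rw [Complex.cos, show Complex.I * ((j : ℂ) - k) * x = -(Complex.I * k * x)
      + (j * x) * Complex.I by ring, show Complex.I * (-(j : ℂ) - k) * x = -(Complex.I * k * x)
      + -(j * x) * Complex.I by ring, Complex.exp_add, Complex.exp_add]
    ring
  · exact Continuous.intervalIntegrable (by fun_prop) _ _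
  · exact Continuous.intervalIntegrable (by fun_prop) _ _

theorem fCoeff_sin (j : ℕ) (k : ℤ) : fCoeff (fun x => (Real.sin (j * x) : ℂ)) k =
    1 / (2 * Real.pi) * (-Complex.I / 2 * ((if (j : ℤ) - k = 0 then (2 * Real.pi : ℂ) else 0)
      - (if -(j : ℤ) - k = 0 then (2 * Real.pi : ℂ) else 0))) := by
  rw [fCoeff, ← integral_exp_int, ← integral_exp_int, ← intervalIntegral.integral_sub,
    ← intervalIntegral.integral_const_mul (-Complex.I / 2)]
  · congr 2
    funext x
    push_cast
    rw [Complex.sin, show Complex.I * ((j : ℂ) - k) * x = -(Complex.I * k * x)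
      + (j * x) * Complex.I by ring, show Complex.I * (-(j : ℂ) - k) * x = -(Complex.I * k * x)
      + -(j * x) * Complex.I by ring, Complex.exp_add, Complex.exp_add]
    ring
  · exact Continuous.intervalIntegrable (by fun_prop) _ _
  · exact Continuous.intervalIntegrable (by fun_prop) _ _

/-- On the modes `k = j` and `k = -j` the sine and cosine coefficients differ exactly by `-i sgn k`;
at `k = 0` the sine coefficient vanishes. -/
theorem fCoeff_sin_eq (j : ℕ) (k : ℤ) : fCoeff (fun x => (Real.sin (j * x) : ℂ)) k =
    -Complex.I * (Int.sign k : ℂ) * fCoeff (fun x => (Real.cos (j * x) : ℂ)) k := by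
  rw [fCoeff_sin, fCoeff_cos]
  rcases lt_trichotomy k 0 with hk | rfl | hk
  · rw [Int.sign_eq_neg_one_of_neg hk, if_neg (by omega)]
    push_cast; ring
  · by_cases hj : (j : ℤ) = 0 <;> simp [hj]
  · rw [Int.sign_eq_one_of_pos hk, if_neg (c := -(j : ℤ) - k = 0) (by omega)]
    push_cast; ring

theorem fCoeff_sum (s : Finset ℕ) (a : ℕ → ℝ) (f : ℕ → ℝ → ℝ) (hf : ∀ j, Continuous (f j))
    (k : ℤ) : fCoeff (fun x => ((∑ j ∈ s, a j * f j x : ℝ) : ℂ)) k =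
      ∑ j ∈ s, (a j : ℂ) * fCoeff (fun x => (f j x : ℂ)) k := by
  simp only [fCoeff]
  push_cast
  simp_rw [Finset.mul_sum]
  rw [intervalIntegral.integral_finsetSum, Finset.mul_sum]
  · refine Finset.sum_congr rfl fun j _ => ?_
    rw [mul_left_comm, ← intervalIntegral.integral_const_mul (a j : ℂ)]
    congr 2
    funext x
    ring
  · intro j _
    have := hf j
    exact Continuous.intervalIntegrable (by fun_prop) _ _

theorem fCoeff_hTerm (n : ℕ) (k : ℤ) : fCoeff (fun x => (hTerm n x : ℂ)) k =
    -Complex.I * (Int.sign k : ℂ) * fCoeff (fun x => (uTerm n x : ℂ)) k := by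
  simp only [hTerm, uTerm]
  rw [fCoeff_sum _ _ (fun j x => Real.sin (j * x)) (fun j => by fun_prop),
    fCoeff_sum _ _ (fun j x => Real.cos (j * x)) (fun j => by fun_prop), Finset.mul_sum]
  exact Finset.sum_congr rfl fun j _ => by rw [fCoeff_sin_eq]; ring

/-! ### The traveling wave -/

section Wave

variable {ε : ℂ}

theorem isH1WithDeriv_powerSum (hε : ‖ε‖ ≤ 1 / 4) :
    IsH1WithDeriv (powerSum uTerm ε) (powerSum uTermDeriv ε) := by
  have hs := summable_uNorm (norm_nonneg ε) hε
  have hper : Function.Periodic (powerSum uTerm ε) (2 * Real.pi) := by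
    intro x
    unfold powerSum uTerm
    congr 1
    funext n
    congr 2
    refine Finset.sum_congr rfl fun k _ => ?_
    rw [mul_add, Real.cos_add_nat_mul_two_pi]
  refine ⟨hper, memLp_powerSum continuous_uTerm abs_uTerm_le hs,
    memLp_powerSum continuous_uTermDeriv abs_uTermDeriv_le hs, fun φ hφ hφp => ?_⟩
  have hφd : Differentiable ℝ φ := hφ.differentiable (by simp)
  have hφc : Continuous (deriv φ) := hφ.continuous_deriv (by exact_mod_cast le_top)
  -- The sum is classically differentiable, so this is ordinary integration by parts; periodicity
  -- cancels the boundary terms.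
  rw [intervalIntegral.integral_mul_deriv_eq_deriv_mul
    (fun x _ => hasDerivAt_powerSum hasDerivAt_uTerm abs_uTerm_le abs_uTermDeriv_le hs x)
    (fun x _ => (hφd x).hasDerivAt)
    ((continuous_powerSum continuous_uTermDeriv abs_uTermDeriv_le hs).intervalIntegrable _ _)
    (hφc.intervalIntegrable _ _)]
  have h1 := hper (-Real.pi)
  have h2 := hφp (-Real.pi)
  rw [show -Real.pi + 2 * Real.pi = Real.pi by ring] at h1 h2
  rw [h1, h2, sub_self, zero_sub]

theorem convergesInH1_powerSum (hε : ‖ε‖ ≤ 1 / 4) :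
    ConvergesInH1 ε (powerSum uTerm ε) (powerSum uTermDeriv ε) := by
  have hs := summable_uNorm (norm_nonneg ε) hε
  refine ⟨isH1WithDeriv_powerSum hε, ?_⟩
  simp_rw [deriv_uTerm]
  have h := (tendsto_eLpNorm_powerSum abs_uTerm_le hs).add
    (tendsto_eLpNorm_powerSum abs_uTermDeriv_le hs)
  rwa [add_zero] at h

theorem isHilbertTransform_powerSum (hε : ‖ε‖ ≤ 1 / 4) :
    IsHilbertTransform (powerSum uTerm ε) (powerSum hTerm ε) := by
  have hs := summable_uNorm (norm_nonneg ε) hε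
  refine ⟨memLp_powerSum continuous_hTerm abs_hTerm_le hs, fun k => ?_⟩
  refine (hasSum_fCoeff_powerSum continuous_hTerm abs_hTerm_le hs k).unique ?_
  simp_rw [fCoeff_hTerm, mul_assoc]
  simpa only [mul_assoc] using (hasSum_fCoeff_powerSum continuous_uTerm abs_uTerm_le hs k).mul_left
    (-Complex.I * (Int.sign k : ℂ))

theorem summable_norm_vCoeff (hε : ‖ε‖ ≤ 1 / 4) :
    Summable fun n => ‖(vCoeff n : ℂ) * ε ^ n‖ := by
  refine (summable_vCoeff (norm_nonneg ε) hε).congr fun n => ?_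
  rw [norm_mul, norm_pow, Complex.norm_real, Real.norm_eq_abs]

theorem wave_eq_powerSum (hε : ‖ε‖ ≤ 1 / 4) (x : ℝ) :
    powerSum hTerm ε x - (∑' n, (vCoeff n : ℂ) * ε ^ n) * powerSum uTermDeriv ε x
      + powerSum uTerm ε x * powerSum uTermDeriv ε x = 0 := by
  have hs := summable_uNorm (norm_nonneg ε) hε
  have hv := summable_norm_vCoeff hε
  have hu := summable_norm_term abs_uTerm_le hs x
  have hw := summable_norm_term abs_uTermDeriv_le hs x
  have hh := summable_norm_term abs_hTerm_le hs x
  have hvw := (summable_norm_sum_mul_antidiagonal_of_summable_norm hv hw).of_norm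
  have huw := (summable_norm_sum_mul_antidiagonal_of_summable_norm hu hw).of_norm
  unfold powerSum
  rw [tsum_mul_tsum_eq_tsum_sum_antidiagonal_of_summable_norm hv hw,
    tsum_mul_tsum_eq_tsum_sum_antidiagonal_of_summable_norm hu hw,
    ← hh.of_norm.tsum_sub hvw, ← (hh.of_norm.sub hvw).tsum_add huw]
  convert tsum_zero with n
  have h := congrArg (fun y : ℝ => (y : ℂ) * ε ^ n) (wave_eq_term n x)
  simp only [Complex.ofReal_zero, zero_mul] at h
  rw [← h]
  push_cast
  rw [add_mul, sub_mul, Finset.sum_mul, Finset.sum_mul]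
  congr 1
  · congr 1
    refine Finset.sum_congr rfl fun p hp => ?_
    rw [mem_antidiagonal] at hp
    rw [← hp, pow_add]; ring
  · refine Finset.sum_congr rfl fun p hp => ?_
    rw [mem_antidiagonal] at hp
    rw [← hp, pow_add]; ring

theorem isTravelingWave_powerSum (hε : ‖ε‖ ≤ 1 / 4) :
    IsTravelingWave (powerSum uTerm ε) (powerSum uTermDeriv ε) (∑' n, (vCoeff n : ℂ) * ε ^ n) :=
  ⟨isH1WithDeriv_powerSum hε, powerSum hTerm ε, isHilbertTransform_powerSum hε,
    ae_of_all _ (wave_eq_powerSum hε)⟩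

theorem summable_h1Norm (hε : ‖ε‖ ≤ 1 / 4) :
    Summable fun n : ℕ => h1Norm (uTerm n) * ‖ε‖ ^ n := by
  refine Summable.of_nonneg_of_le (fun n => mul_nonneg (Real.sqrt_nonneg _) (by positivity))
    (fun n => ?_) ((summable_uNorm (norm_nonneg ε) hε).mul_left (Real.sqrt (4 * Real.pi)))
  rw [← mul_assoc]
  exact mul_le_mul_of_nonneg_right (h1Norm_uTerm_le n) (by positivity)

end Wave

/-! ### Numerical bounds for `x*` -/

theorem B_lower : 3.05 ≤ B := by
  rw [B]
  apply Real.le_sqrt_of_sq_le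
  nlinarith [Real.pi_gt_d2]

theorem B_upper : B ≤ 3.1 := by
  rw [B, Real.sqrt_le_left (by norm_num)]
  nlinarith [Real.pi_lt_d2, Real.pi_pos]

theorem arsinh_le_self {y : ℝ} (hy : 0 ≤ y) : Real.arsinh y ≤ y := by
  have h := Real.arsinh_le_arsinh.2 (Real.self_le_sinh_iff.2 hy)
  rwa [Real.arsinh_sinh] at h

/-- The set whose supremum is `x*`. -/
def xStarSet : Set ℝ := {x : ℝ | 0 ≤ x ∧
    8 * x + Real.sqrt 17 * x ^ 2 - 4 ≤
      -2 * Real.sqrt ((2 * B * x ^ 2 + 4 * x) *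
        (x * Real.sqrt (x ^ 2 + 5 / 2) + 5 / 2 * Real.arsinh (Real.sqrt (2 / 5) * x)))}

/-- Beyond `0.2349` the left side exceeds about `-1.894`, while the right side is at most `-2 *
0.949`. The estimates use only lower bounds on `x`, hence cover all larger `x`. -/
theorem le_of_mem_xStarSet {x : ℝ} (hx : x ∈ xStarSet) : x ≤ 0.2349 := by
  by_contra! hlt
  have h := hx.2
  have hB := B_lower
  have hx2 : (0.05517 : ℝ) ≤ x ^ 2 := by nlinarith
  have h17 : 4.12 ≤ Real.sqrt 17 := Real.le_sqrt_of_sq_le (by norm_num)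
  have hs : 1.598 ≤ Real.sqrt (x ^ 2 + 5 / 2) := Real.le_sqrt_of_sq_le (by linarith)
  have h25 : 0.6324 ≤ Real.sqrt (2 / 5) := Real.le_sqrt_of_sq_le (by norm_num)
  have hy : 0.1485 ≤ Real.sqrt (2 / 5) * x := by nlinarith
  have ha : 0.137 ≤ Real.arsinh (Real.sqrt (2 / 5) * x) := by
    refine le_trans ?_ (Real.arsinh_le_arsinh.2 hy)
    rw [Real.arsinh]
    have h1 : 1.0109 ≤ Real.sqrt (1 + 0.1485 ^ 2) := Real.le_sqrt_of_sq_le (by norm_num)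
    have h2 : (1.159 : ℝ) ≤ 0.1485 + Real.sqrt (1 + 0.1485 ^ 2) := by linarith
    -- The bound `log t ≥ 1 - 1/t` at `t = 1.159` suffices for `arsinh y = log (y + √(1 + y²))`.
    have h3 := Real.one_sub_inv_le_log_of_pos (x := 1.159) (by norm_num)
    have h4 := Real.log_le_log (by norm_num) h2
    have h5 : (0.137 : ℝ) ≤ 1 - 1.159⁻¹ := by norm_num
    linarith
  have f1 : 1.27 ≤ 2 * B * x ^ 2 + 4 * x := by nlinarith
  have f2 : 0.71 ≤ x * Real.sqrt (x ^ 2 + 5 / 2)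
      + 5 / 2 * Real.arsinh (Real.sqrt (2 / 5) * x) := by nlinarith
  have hr : 0.949 ≤ Real.sqrt ((2 * B * x ^ 2 + 4 * x) *
        (x * Real.sqrt (x ^ 2 + 5 / 2) + 5 / 2 * Real.arsinh (Real.sqrt (2 / 5) * x))) := by
    apply Real.le_sqrt_of_sq_le
    calc (0.949 : ℝ) ^ 2 ≤ 1.27 * 0.71 := by norm_num
      _ ≤ _ := mul_le_mul f1 f2 (by norm_num) (by linarith)
  nlinarith

theorem mem_xStarSet : (0.226 : ℝ) ∈ xStarSet := by
  refine ⟨by norm_num, ?_⟩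
  have hB := B_upper
  have h17 : Real.sqrt 17 ≤ 4.13 := (Real.sqrt_le_left (by norm_num)).2 (by norm_num)
  have hs : Real.sqrt (0.226 ^ 2 + 5 / 2) ≤ 1.6 :=
    (Real.sqrt_le_left (by norm_num)).2 (by norm_num)
  have h25 : Real.sqrt (2 / 5) ≤ 0.64 := (Real.sqrt_le_left (by norm_num)).2 (by norm_num)
  have ha := arsinh_le_self (y := Real.sqrt (2 / 5) * 0.226) (by positivity)
  have hB0 : 0 ≤ B := Real.sqrt_nonneg _
  have f1 : 2 * B * 0.226 ^ 2 + 4 * 0.226 ≤ 1.221 := by nlinarith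
  have f2 : 0.226 * Real.sqrt (0.226 ^ 2 + 5 / 2)
      + 5 / 2 * Real.arsinh (Real.sqrt (2 / 5) * 0.226) ≤ 0.7233 := by linarith
  have hr : Real.sqrt ((2 * B * 0.226 ^ 2 + 4 * 0.226) * (0.226 * Real.sqrt (0.226 ^ 2 + 5 / 2)
      + 5 / 2 * Real.arsinh (Real.sqrt (2 / 5) * 0.226))) ≤ 0.99 := by
    rw [Real.sqrt_le_left (by norm_num)]
    calc _ ≤ (1.221 : ℝ) * 0.7233 := by
          refine mul_le_mul f1 f2 ?_ (by norm_num)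
          have : 0 ≤ Real.arsinh (Real.sqrt (2 / 5) * 0.226) :=
            Real.arsinh_nonneg_iff.2 (by positivity)
          positivity
      _ ≤ _ := by norm_num
  linarith

theorem xStar_le : xStar ≤ 0.2349 :=
  csSup_le ⟨_, mem_xStarSet⟩ fun _ hx => le_of_mem_xStarSet hx

theorem le_xStar : 0.226 ≤ xStar :=
  le_csSup ⟨0.2349, fun _ hx => le_of_mem_xStarSet hx⟩ mem_xStarSet

end BurgersHilbert

open BurgersHilbert in
theorem mainTheorem3 :
    |xStar - 0.23| < 0.005 ∧
    ∀ ε : ℂ, ‖ε‖ < xStar →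
      Summable (fun n : ℕ => |vCoeff n| * ‖ε‖ ^ n) ∧
      Summable (fun n : ℕ => h1Norm (uTerm n) * ‖ε‖ ^ n) ∧
      ∃ (u w : ℝ → ℂ) (v : ℂ),
        HasSum (fun n : ℕ => (vCoeff n : ℂ) * ε ^ n) v ∧
        (∀ x : ℝ, HasSum (fun n : ℕ => (uTerm n x : ℂ) * ε ^ n) (u x)) ∧
        ConvergesInH1 ε u w ∧
        IsTravelingWave u w v := by
  have h1 := xStar_le
  have h2 := le_xStar
  refine ⟨by rw [abs_lt]; constructor <;> linarith, fun ε hε => ?_⟩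
  -- For convergence and the equation, only `x* ≤ 1/4` matters.
  have hε' : ‖ε‖ ≤ 1 / 4 := by linarith
  exact ⟨summable_vCoeff (norm_nonneg ε) hε', summable_h1Norm hε', powerSum uTerm ε,
    powerSum uTermDeriv ε, _, (summable_norm_vCoeff hε').of_norm.hasSum,
    hasSum_powerSum abs_uTerm_le (summable_uNorm (norm_nonneg ε) hε'),
    convergesInH1_powerSum hε', isTravelingWave_powerSum hε'⟩
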